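/- Let $F=\mathbb Q(\alpha)$ be the field of rational functions in an indeterminate $\alpha$ and let $\Lambda_F=F[p_1,p_2,\dots]$ be the ring of symmetric functions over $F$ in infinitely many variables, with power sums $p_k$, monomial symmetric functions $m_\lambda$, and the scalar product $\langle p_\lambda,p_\mu\rangle=\delta_{\lambda\mu}\,\alpha^{l(\lambda)}z_\lambda$, where $p_\lambda=p_{\lambda_1}p_{\lambda_2}\cdots$, $z_\lambda=\prod_k k^{m_k(\lambda)}m_k(\lambda)!$ and $m_k(\lambda)$ is the multiplicity of $k$ as a part of $\lambda$. Let $\le$ be the dominance order on partitions of the same weight. Let $P_\lambda$ be the Jack functions, determined by $P_\lambda=m_\lambda+\sum_{\mu<\lambda}c_{\lambda\mu}m_\mu$ with $c_{\lambda\mu}\in F$, and $\langle P_\lambda,P_\mu\rangle=0$ for $\lambda\ne\mu$. Let $J_\lambda=\sum_\mu v_{\lambda\mu}m_\mu$ be the multiple of $P_\lambda$ with $v_{\lambda,(1^{|\lambda|})}=|\lambda|!$. Put $Q_\lambda=\langle P_\lambda,P_\lambda\rangle^{-1}P_\lambda$ and $q_\lambda=Q_{(\lambda_1)}Q_{(\lambda_2)}\cdots$,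 and write $Q_\mu=\sum_\lambda C_{\mu\lambda}q_\lambda$. For a partition $\lambda=(\lambda_1\ge\lambda_2\ge\cdots)$, rows $i<j$ and $0<k\le\lambda_j$, let $r^i_j(k).\lambda$ be the partition obtained from $\lambda$ by moving $k$ squares from row $j$ to row $i$ and rearranging the rows in decreasing order. If $\mu=r^i_j(k).\lambda$, put $$r_{\lambda\mu}=(1+\delta_{\lambda_i\lambda_j})^{-1}\,m_{\lambda_i}(\lambda)\,\bigl(m_{\lambda_j}(\lambda)-\delta_{\lambda_i\lambda_j}\bigr)(\lambda_i-\lambda_j+2k),$$ which does not depend on the choice of $i,j,k$. Put $e'_\lambda=\tfrac12\alpha\sum_i\lambda_i^2-\sum_i i\lambda_i$. A moving up filtration from $\mu$ to $\lambda$ is a finite sequence of partitions $\delta=(\lambda^0,\lambda^1,\dots,\lambda^s)$ with $\lambda^0=\mu$, $\lambda^s=\lambda$, such that each $\lambda^{t+1}$ is of the form $r^i_j(k).\lambda^{t}$. For partitions $\mu<\lambda$ and such $\delta$, put $$f^\lambda(\delta)=\prod_{t=0}^{s-1}\frac{r_{\lambda^t\lambda^{t+1}}}{e'_\lambda-e'_{\lambda^t}},\qquad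 f_\mu(\delta)=\prod_{t=0}^{s-1}\frac{r_{\lambda^t\lambda^{t+1}}}{e'_\mu-e'_{\lambda^{t+1}}}.$$ **Theorem.** For all partitions $\mu<\lambda$, $$v_{\lambda\mu}=v_{\lambda\lambda}\sum_\delta f^\lambda(\delta),\qquad C_{\mu\lambda}=C_{\mu\mu}\sum_\delta f_\mu(\delta),\qquad C_{\mu\mu}=1,$$ where both sums are over the (finitely many) moving up filtrations $\delta$ from $\mu$ to $\lambda$. -/

import Mathlib

noncomputable section

namespace JackLB

open scoped Nat

/-! ### Partitions -/

/-- The rows `λ₁ ≥ λ₂ ≥ ⋯ ≥ λ_l > 0` of a partition. -/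
def rows {n : ℕ} (lam : n.Partition) : List ℕ := lam.parts.sort (· ≥ ·)

/-- The dominance order `μ ≤ λ`: `μ₁ + ⋯ + μ_i ≤ λ₁ + ⋯ + λ_i` for all `i`. -/
def DomLE {n : ℕ} (mu lam : n.Partition) : Prop :=
  ∀ i : ℕ, ((rows mu).take i).sum ≤ ((rows lam).take i).sum

/-- The strict dominance order `μ < λ`. -/
def DomLT {n : ℕ} (mu lam : n.Partition) : Prop := DomLE mu lam ∧ mu ≠ lam

/-- The multiplicity `m_k(λ)` of `k` as a part of `λ`. -/
def mult {n : ℕ} (k : ℕ) (lam : n.Partition) : ℕ := lam.parts.count k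

/-- `z_λ = ∏_k k ^ m_k(λ) * m_k(λ)!`. -/
def zed {n : ℕ} (lam : n.Partition) : ℕ :=
  ∏ k ∈ lam.parts.toFinset, k ^ mult k lam * (mult k lam)!

/-- The partition `(n)`; it is the empty partition for `n = 0`. -/
abbrev oneRow (n : ℕ) : n.Partition := Nat.Partition.indiscrete n

/-- The partition `(1 ^ n)`. -/
def oneCol (n : ℕ) : n.Partition where
  parts := Multiset.replicate n 1
  parts_pos h := by rw [Multiset.eq_of_mem_replicate h]; exact Nat.one_pos
  parts_sum := by simp

/-! ### Symmetric functions over `ℚ(α)` -/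

/-- The field `F = ℚ(α)` of rational functions. -/
abbrev F : Type := RatFunc ℚ

/-- The indeterminate `α`. -/
def α : F := RatFunc.X

/-- The ring `Λ_F = F[p₁, p₂, …]` of symmetric functions, as the polynomial ring in the power
sums; `realize` below gives the symmetric function in the variables `x₀, x₁, …`. -/
abbrev SymF : Type := MvPolynomial ℕ+ F

/-- The power sum `p_k` (used for `k ≥ 1`). -/
def p (k : ℕ) : SymF := MvPolynomial.X k.toPNat'

/-- `p_λ = p_{λ₁} p_{λ₂} ⋯`. -/
def pPart {n : ℕ} (lam : n.Partition) : SymF := (lam.parts.map p).prod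

/-- The formal power series `∑_i x_i ^ k` (used for `k ≥ 1`). -/
def powerSumSeries (k : ℕ) : MvPowerSeries ℕ F := by
  classical exact fun d => if ∃ i, d = Finsupp.single i k then 1 else 0

/-- The homomorphism sending a polynomial in the `p_k` to the symmetric function in the variables
`x₀, x₁, …` which it represents. -/
def realize : SymF →ₐ[F] MvPowerSeries ℕ F :=
  MvPolynomial.aeval fun k : ℕ+ => powerSumSeries k

/-- The monomial symmetric function `m_λ`: the sum of all distinct monomials in `x₀, x₁, …` whose
nonzero exponents are the parts of `λ`. -/
def monomialSym {n : ℕ} (lam : n.Partition) : MvPowerSeries ℕ F := by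
  classical exact fun d => if d.support.val.map d = lam.parts then 1 else 0

/-- `α ^ l(λ) * z_λ` for the partition `λ` in which `k` occurs `d k` times. -/
def weight (d : ℕ+ →₀ ℕ) : F := d.prod fun k e => (α * (k : ℕ)) ^ e * (e ! : F)

/-- The Jack scalar product on `Λ_F`, the bilinear form for which the monomials in the power sums
are orthogonal and have square norms `α ^ l(λ) * z_λ`; see `jackInner_pPart`. -/
def jackInner : LinearMap.BilinForm F SymF :=
  (MvPolynomial.basisMonomials ℕ+ F).constr F fun d => weight d • MvPolynomial.lcoeff F d

lemma pPart_eq {n : ℕ} (lam : n.Partition) :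
    pPart lam = MvPolynomial.monomial (Multiset.toFinsupp (lam.parts.map Nat.toPNat')) 1 := by
  unfold pPart
  induction lam.parts using Multiset.induction_on with
  | empty => simp
  | cons a s ih =>
    rw [Multiset.map_cons, Multiset.prod_cons, ih, Multiset.map_cons, ← Multiset.singleton_add,
      map_add, Multiset.toFinsupp_singleton, p, MvPolynomial.X, MvPolynomial.monomial_mul, one_mul]

lemma toPNat'_injOn {n : ℕ} (lam : n.Partition) :
    Set.InjOn Nat.toPNat' {k | k ∈ lam.parts} := by
  intro a ha b hb h
  have h1 : (a.toPNat' : ℕ) = b.toPNat' := by rw [h]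
  have ha' := lam.parts_pos ha
  have hb' := lam.parts_pos hb
  simpa [Nat.toPNat'_coe, ha', hb'] using h1

/-- The defining property `⟨p_λ, p_μ⟩ = δ_{λμ} α ^ l(λ) z_λ` of the Jack scalar product. -/
theorem jackInner_pPart {n k : ℕ} (lam : n.Partition) (mu : k.Partition) :
    jackInner (pPart lam) (pPart mu) =
      if lam.parts = mu.parts then α ^ lam.parts.card * (zed lam : F) else 0 := by
  have key : ∀ d e : ℕ+ →₀ ℕ, jackInner (MvPolynomial.monomial d 1) (MvPolynomial.monomial e 1) =
      if d = e then weight d else 0 := by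
    intro d e
    have h1 : (MvPolynomial.monomial d (1 : F)) = MvPolynomial.basisMonomials ℕ+ F d := by simp
    rw [h1, jackInner, Module.Basis.constr_basis, LinearMap.smul_apply, MvPolynomial.lcoeff_apply,
      MvPolynomial.coeff_monomial]
    by_cases h : d = e
    · simp [h]
    · simp [h, Ne.symm h]
  rw [pPart_eq, pPart_eq, key]
  have hinv : ∀ {m : ℕ} (nu : m.Partition),
      (nu.parts.map Nat.toPNat').map (fun k : ℕ+ => (k : ℕ)) = nu.parts := by
    intro m nu
    rw [Multiset.map_map]
    conv_rhs => rw [← Multiset.map_id nu.parts]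
    refine Multiset.map_congr rfl fun x hx => ?_
    simp [Nat.toPNat'_coe, nu.parts_pos hx]
  by_cases h : lam.parts = mu.parts
  · rw [if_pos h, if_pos (by rw [h])]
    have hsupp : (Multiset.toFinsupp (lam.parts.map Nat.toPNat')).support =
        lam.parts.toFinset.image Nat.toPNat' := by
      rw [Multiset.toFinsupp_support, Multiset.toFinset_map]
    have hinj : Set.InjOn Nat.toPNat' (lam.parts.toFinset : Set ℕ) := by
      intro a ha b hb
      exact toPNat'_injOn lam (by simpa using ha) (by simpa using hb)
    rw [weight, Finsupp.prod, hsupp, Finset.prod_image hinj, zed]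
    have hcard : lam.parts.card = ∑ k ∈ lam.parts.toFinset, lam.parts.count k :=
      (Multiset.toFinset_sum_count_eq _).symm
    rw [hcard, ← Finset.prod_pow_eq_pow_sum, Nat.cast_prod, ← Finset.prod_mul_distrib]
    refine Finset.prod_congr rfl fun k hk => ?_
    have hk' : k ∈ lam.parts := by simpa using hk
    have hc : Multiset.count k.toPNat' (lam.parts.map Nat.toPNat') = lam.parts.count k :=
      Multiset.count_map_eq_count _ _ (toPNat'_injOn lam) _ hk'
    have hk0 : 0 < k := lam.parts_pos hk'
    rw [Multiset.toFinsupp_apply, hc, Nat.toPNat'_coe, if_pos hk0, mult]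
    push_cast
    rw [mul_pow]
    ring
  · rw [if_neg h, if_neg]
    intro h'
    apply h
    have h2 := Multiset.toFinsupp.injective h'
    rw [← hinv lam, ← hinv mu, h2]

/-! ### Jack functions -/

/-- The family of the Jack functions `P_λ`: `P_λ = ∑_{μ ≤ λ} c_{λμ} m_μ` with `c_{λλ} = 1`, and
`⟨P_λ, P_μ⟩ = 0` for `λ ≠ μ`. -/
structure IsJackP (P : ∀ n : ℕ, n.Partition → SymF) : Prop where
  triangular : ∀ (n : ℕ) (lam : n.Partition), ∃ c : n.Partition → F,
    c lam = 1 ∧ (∀ mu, ¬ DomLE mu lam → c mu = 0) ∧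
      realize (P n lam) = ∑ mu, c mu • monomialSym mu
  orthogonal : ∀ (n k : ℕ) (lam : n.Partition) (mu : k.Partition), lam.parts ≠ mu.parts →
    jackInner (P n lam) (P k mu) = 0

/-- The normalization `J_λ = ∑_μ v_{λμ} m_μ` of the Jack functions: `J_λ` is a multiple of `P_λ`,
and `v_{λ,(1^n)} = n!` for `n = |λ|`. -/
structure IsJackJ (P J : ∀ n : ℕ, n.Partition → SymF)
    (v : ∀ n : ℕ, n.Partition → n.Partition → F) : Prop where
  multiple : ∀ (n : ℕ) (lam : n.Partition), ∃ c : F, J n lam = c • P n lam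
  expansion : ∀ (n : ℕ) (lam : n.Partition),
    realize (J n lam) = ∑ mu, v n lam mu • monomialSym mu
  normalized : ∀ (n : ℕ) (lam : n.Partition), v n lam (oneCol n) = (n ! : F)

/-- The dual Jack function `Q_λ = ⟨P_λ, P_λ⟩⁻¹ P_λ`. -/
def jackQ (P : ∀ n : ℕ, n.Partition → SymF) (n : ℕ) (lam : n.Partition) : SymF :=
  (jackInner (P n lam) (P n lam))⁻¹ • P n lam

/-- The generalized homogeneous function `q_λ = Q_{(λ₁)} Q_{(λ₂)} ⋯`. -/
def genHom (P : ∀ n : ℕ, n.Partition → SymF) {n : ℕ} (lam : n.Partition) : SymF :=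
  (lam.parts.map fun k => jackQ P k (oneRow k)).prod

/-! ### Moving up -/

/-- Move `k` squares from row `j` to row `i` (rows are numbered from `0`), before rearranging. -/
def moveRows (l : List ℕ) (i j k : ℕ) : List ℕ :=
  (l.set i (l.getD i 0 + k)).set j (l.getD j 0 - k)

/-- `r_j^i(k)` is a moving up operator for `λ`, and `μ = r_j^i(k).λ`. -/
def IsMove {n : ℕ} (lam mu : n.Partition) (i j k : ℕ) : Prop :=
  i < j ∧ 0 < k ∧ k ≤ (rows lam).getD j 0 ∧
    mu.parts = (moveRows (rows lam) i j k : Multiset ℕ).filter (· ≠ 0)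

/-- `μ ∈ M^*(λ)`. -/
def MovesUp {n : ℕ} (lam mu : n.Partition) : Prop := ∃ i j k, IsMove lam mu i j k

/-- `e'_λ = (α / 2) ∑_i λ_i ^ 2 - ∑_i i λ_i`, with `i` starting from `1`. -/
def ePrime {n : ℕ} (lam : n.Partition) : F :=
  α / 2 * ∑ i ∈ Finset.range (rows lam).length, ((rows lam).getD i 0 : F) ^ 2 -
    ∑ i ∈ Finset.range (rows lam).length, ((i : F) + 1) * ((rows lam).getD i 0 : F)

/-- The number
`(1 + δ_{λ_i λ_j})⁻¹ m_{λ_i}(λ) (m_{λ_j}(λ) - δ_{λ_i λ_j}) (λ_i - λ_j + 2k)`. -/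
def moveCoeff {n : ℕ} (lam : n.Partition) (i j k : ℕ) : F :=
  let a := (rows lam).getD i 0
  let b := (rows lam).getD j 0
  let δ : F := if a = b then 1 else 0
  (1 + δ)⁻¹ * (mult a lam : F) * ((mult b lam : F) - δ) * ((a : F) - (b : F) + 2 * (k : F))

open Classical in
/-- `r_{λμ}`: the number `moveCoeff` if `μ = r_j^i(k).λ` (it does not depend on the choice of
`i, j, k`, see `r_eq_moveCoeff`), `e'_λ` if `μ = λ`, and `0` otherwise. -/
def r {n : ℕ} (lam mu : n.Partition) : F :=
  if h : ∃ t : ℕ × ℕ × ℕ, IsMove lam mu t.1 t.2.1 t.2.2 then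
    moveCoeff lam h.choose.1 h.choose.2.1 h.choose.2.2
  else if lam = mu then ePrime lam else 0

lemma rows_coe {n : ℕ} (lam : n.Partition) : (rows lam : Multiset ℕ) = lam.parts :=
  Multiset.sort_eq _ _

lemma rows_antitone {n : ℕ} (lam : n.Partition) {i j : ℕ} (h : i < j) :
    (rows lam).getD j 0 ≤ (rows lam).getD i 0 := by
  by_cases hj : j < (rows lam).length
  · have hs : (rows lam).Pairwise (· ≥ ·) := Multiset.pairwise_sort _ _
    rw [List.getD_eq_getElem _ _ hj, List.getD_eq_getElem _ _ (h.trans hj)]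
    exact List.pairwise_iff_getElem.1 hs i j (h.trans hj) hj h
  · rw [List.getD_eq_default _ _ (not_lt.1 hj)]
    exact Nat.zero_le _

lemma moveRows_add {l : List ℕ} {i j k : ℕ} (hij : i < j) (hk : 0 < k) (hj : k ≤ l.getD j 0) :
    (moveRows l i j k : Multiset ℕ) + {l.getD i 0, l.getD j 0} =
      (l : Multiset ℕ) + {l.getD i 0 + k, l.getD j 0 - k} := by
  have hjl : j < l.length := by
    by_contra hcon
    rw [List.getD_eq_default _ _ (not_lt.1 hcon)] at hj
    omega
  have hil : i < l.length := hij.trans hjl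
  have hset : ∀ (l : List ℕ) (i a : ℕ) (_ : i < l.length),
      ((l.set i a : List ℕ) : Multiset ℕ) + {l.getD i 0} = (l : Multiset ℕ) + {a} := by
    intro l
    induction l with
    | nil => intro i a h; simp at h
    | cons b l ih =>
      intro i a h
      cases i with
      | zero =>
        simp only [List.set_cons_zero, List.getD_cons_zero, ← Multiset.cons_coe,
          ← Multiset.singleton_add]
        abel
      | succ i =>
        have := ih i a (by simpa using h)
        simp only [List.set_cons_succ, List.getD_cons_succ, ← Multiset.cons_coe,
          ← Multiset.singleton_add] at this ⊢
        rw [add_assoc, this, add_assoc]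
  have h1 := hset l i (l.getD i 0 + k) hil
  have h2 := hset (l.set i (l.getD i 0 + k)) j (l.getD j 0 - k) (by simpa using hjl)
  have h3 : (l.set i (l.getD i 0 + k)).getD j 0 = l.getD j 0 := by
    simp [List.getD, hij.ne]
  rw [h3] at h2
  have e : ∀ a b : ℕ, ({a, b} : Multiset ℕ) = {b} + {a} := fun a b => by
    rw [add_comm]; rfl
  rw [moveRows, e, e, ← add_assoc, h2, add_right_comm, h1]
  abel

lemma IsMove.count {n : ℕ} {lam mu : n.Partition} {i j k : ℕ} (h : IsMove lam mu i j k)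
    {x : ℕ} (hx : x ≠ 0) :
    mu.parts.count x + ((if x = (rows lam).getD i 0 then 1 else 0) +
        if x = (rows lam).getD j 0 then 1 else 0) =
      lam.parts.count x + ((if x = (rows lam).getD i 0 + k then 1 else 0) +
        if x = (rows lam).getD j 0 - k then 1 else 0) := by
  obtain ⟨hij, hk, hj, hmu⟩ := h
  have h1 := congrArg (Multiset.count x) (moveRows_add hij hk hj)
  rw [rows_coe] at h1
  rw [hmu, Multiset.count_filter_of_pos (p := (· ≠ 0)) hx]
  simp only [Multiset.count_add, Multiset.insert_eq_cons, Multiset.count_cons,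
    Multiset.count_singleton] at h1
  omega

set_option maxHeartbeats 2000000 in
/-- `r_{λμ}` is given by the formula for every moving up operator taking `λ` to `μ`. -/
theorem r_eq_moveCoeff {n : ℕ} {lam mu : n.Partition} {i j k : ℕ} (h : IsMove lam mu i j k) :
    r lam mu = moveCoeff lam i j k := by
  have hex : ∃ t : ℕ × ℕ × ℕ, IsMove lam mu t.1 t.2.1 t.2.2 := ⟨(i, j, k), h⟩
  rw [r, dif_pos hex]
  have h' := hex.choose_spec
  generalize hex.choose = t at h'
  obtain ⟨i', j', k'⟩ := t
  simp only at h' ⊢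
  have c1 := fun x (hx : x ≠ 0) => h.count hx
  have c2 := fun x (hx : x ≠ 0) => h'.count hx
  have m1 := rows_antitone lam h.1
  have m2 := rows_antitone lam h'.1
  have k1 := h.2.1
  have k2 := h'.2.1
  have l1 := h.2.2.1
  have l2 := h'.2.2.1
  unfold moveCoeff
  generalize (rows lam).getD i 0 = a at *
  generalize (rows lam).getD j 0 = b at *
  generalize (rows lam).getD i' 0 = a' at *
  generalize (rows lam).getD j' 0 = b' at *
  have s1 : a + k = a' + k' := by
    rcases lt_trichotomy (a + k) (a' + k') with hl | hl | hl
    · have u1 := c1 (a' + k') (by omega)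
      have u2 := c2 (a' + k') (by omega)
      clear c1 c2
      split_ifs at u1 u2 <;> omega
    · exact hl
    · have u1 := c1 (a + k) (by omega)
      have u2 := c2 (a + k) (by omega)
      clear c1 c2
      split_ifs at u1 u2 <;> omega
  have s2 : a = a' := by
    rcases lt_trichotomy a a' with hl | hl | hl
    · have u1 := c1 a' (by omega)
      have u2 := c2 a' (by omega)
      clear c1 c2
      split_ifs at u1 u2 <;> omega
    · exact hl
    · have u1 := c1 a (by omega)
      have u2 := c2 a (by omega)
      clear c1 c2
      split_ifs at u1 u2 <;> omega
  have s3 : b = b' := by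
    rcases lt_trichotomy b b' with hl | hl | hl
    · have u1 := c1 b' (by omega)
      have u2 := c2 b' (by omega)
      clear c1 c2
      split_ifs at u1 u2 <;> omega
    · exact hl
    · have u1 := c1 b (by omega)
      have u2 := c2 b (by omega)
      clear c1 c2
      split_ifs at u1 u2 <;> omega
  have s4 : k = k' := by omega
  subst s2 s3 s4
  rfl

/-- The set of the moving up filtrations `δ = (λ⁰, λ¹, …, λˢ)` with `λ⁰ = μ` and `λˢ = λ`: each
`λ^{i+1}` lies in `M^*(λ^i)`. -/
def filtrationSet {n : ℕ} (mu lam : n.Partition) : Set (List n.Partition) :=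
  {δ | δ.head? = some mu ∧ δ.getLast? = some lam ∧ δ.IsChain MovesUp}

lemma MovesUp.sq_lt {n : ℕ} {lam mu : n.Partition} (h : MovesUp lam mu) :
    (lam.parts.map (· ^ 2)).sum < (mu.parts.map (· ^ 2)).sum := by
  obtain ⟨i, j, k, hij, hk, hj, hmu⟩ := h
  have h1 := congrArg (fun s : Multiset ℕ => (s.map (· ^ 2)).sum) (moveRows_add hij hk hj)
  have hf : ∀ s : Multiset ℕ, ((s.filter (· ≠ 0)).map (· ^ 2)).sum = (s.map (· ^ 2)).sum := by
    intro s
    induction s using Multiset.induction_on with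
    | empty => simp
    | cons a s ih =>
      by_cases ha : a = 0
      · simpa [ha] using ih
      · simpa [ha] using ih
  rw [hmu, hf]
  have m1 := rows_antitone lam hij
  rw [rows_coe] at h1
  simp only [Multiset.map_add, Multiset.sum_add, Multiset.insert_eq_cons, Multiset.map_cons,
    Multiset.sum_cons, Multiset.map_singleton, Multiset.sum_singleton] at h1
  generalize (rows lam).getD i 0 = a at *
  generalize hb : (rows lam).getD j 0 = b at *
  obtain ⟨c, rfl⟩ := Nat.exists_eq_add_of_le hj
  have : k + c - k = c := by omega
  rw [this] at h1
  nlinarith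

lemma filtrationSet_finite {n : ℕ} (mu lam : n.Partition) : (filtrationSet mu lam).Finite := by
  refine (List.finite_length_le n.Partition (Fintype.card n.Partition)).subset ?_
  rintro δ ⟨-, -, hδ⟩
  have hlt : δ.Pairwise fun a b : n.Partition =>
      (a.parts.map (· ^ 2)).sum < (b.parts.map (· ^ 2)).sum := by
    have : IsTrans n.Partition fun a b : n.Partition =>
      (a.parts.map (· ^ 2)).sum < (b.parts.map (· ^ 2)).sum := ⟨fun _ _ _ => lt_trans⟩
    exact (hδ.imp fun _ _ h => h.sq_lt).pairwise
  have hnd : δ.Nodup := hlt.imp fun h e => by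
    rw [e] at h
    exact lt_irrefl _ h
  exact hnd.length_le_card

/-- The finite set of the moving up filtrations from `μ` to `λ`. -/
def filtrations {n : ℕ} (mu lam : n.Partition) : Finset (List n.Partition) :=
  (filtrationSet_finite mu lam).toFinset

/-- `f^λ(δ) = ∏_{i=0}^{s-1} r_{λ^i λ^{i+1}} / (e'_λ - e'_{λ^i})`. -/
def fUp {n : ℕ} (lam : n.Partition) (δ : List n.Partition) : F :=
  (List.zipWith (fun a b => r a b / (ePrime lam - ePrime a)) δ δ.tail).prod

/-- `f_μ(δ) = ∏_{i=0}^{s-1} r_{λ^i λ^{i+1}} / (e'_μ - e'_{λ^{i+1}})`. -/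
def fDown {n : ℕ} (mu : n.Partition) (δ : List n.Partition) : F :=
  (List.zipWith (fun a b => r a b / (ePrime mu - ePrime b)) δ δ.tail).prod

end JackLB

end

noncomputable section

namespace JackLB

open scoped Nat
open MvPolynomial

/-! ### The adjoint of multiplication by a power sum -/

/-! Jack functions are eigenfunctions of a Laplace–Beltrami operator `D` (`lbOp`) that acts on
products of the one-row functions by moving squares up. Both expansions solve the resulting
eigenvalue recursions.

Let `g_n` be given by Newton's recursion `α n g_n = ∑ p_k g_{n-k}`. The adjoint of multiplication by
`p_k` is the derivation `α k ∂/∂p_k`, and it sends `g_n` to `g_{n-k}`. Hence multiplying by `p_k`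
changes coefficients of monomials exactly as it changes scalar products with products `g_μ`, so the
`g_μ` are dual to the `m_μ` (`coeff_realize`). In particular `Q_{(n)} = g_n` and `q_λ = g_λ`
(`jackQ_oneRow`, `genHom_eq`).

`D` is self-adjoint and of second order, so on a product it is determined by its values on the
factors and by a bilinear term on pairs of factors. Each `g_n` is an eigenfunction (`lbOp_gh`), and
the pair term turns `g_a g_b` into a combination of the products `g_{a+k} g_{b-k}` (`carre_gh`).
Collecting equal results gives `D g_λ = e'_λ g_λ + ∑ r_{λμ} g_μ` over the upward moves (`lbOp_ghM`).

By duality `D` is triangular on the `P_λ`. Self-adjointness and orthogonality remove the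
off-diagonal entries, so `D P_λ = e'_λ P_λ` (`lbOp_jackP`). Pairing with `g_μ` gives `(e'_λ - e'_μ)
v_{λμ} = ∑_ν r_{μν} v_{λν}`, and expanding `D Q_μ` in the `g_ν` gives `(e'_μ - e'_ν) C_{μν} = ∑_κ
C_{μκ} r_{κν}`. For `μ < λ` the constant terms in `α` of `e'_μ` and `e'_λ` differ, so one may
divide. The sums over filtrations satisfy the same recursions on detaching the first or the last
step, and induction along the dominance order concludes. -/

lemma alpha_ne_zero : α ≠ 0 := RatFunc.X_ne_zero

/-- The power sum `p_{i+1}`. -/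
def pw (i : ℕ) : SymF := X i.succPNat

/-- The derivation `α (i+1) ∂/∂p_{i+1}`, adjoint to the multiplication by `p_{i+1}`. -/
def pd (i : ℕ) : Derivation F SymF SymF := (α * ((i : F) + 1)) • pderiv i.succPNat

lemma alpha_mul_succ_ne_zero (i : ℕ) : α * ((i : F) + 1) ≠ 0 :=
  mul_ne_zero alpha_ne_zero (by exact_mod_cast Nat.succ_ne_zero i)

lemma weight_ne_zero (d : ℕ+ →₀ ℕ) : weight d ≠ 0 := by
  rw [weight, Finsupp.prod, Finset.prod_ne_zero_iff]
  intro k _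
  refine mul_ne_zero (pow_ne_zero _ (mul_ne_zero alpha_ne_zero ?_)) ?_
  · exact_mod_cast k.ne_zero
  · exact_mod_cast Nat.factorial_ne_zero _

lemma jackInner_monomial (d : ℕ+ →₀ ℕ) (f : SymF) :
    jackInner (monomial d 1) f = weight d * coeff d f := by
  have h1 : (monomial d (1 : F)) = basisMonomials ℕ+ F d := by simp
  rw [h1, jackInner, Module.Basis.constr_basis, LinearMap.smul_apply, lcoeff_apply, smul_eq_mul]

lemma weight_add_single (d : ℕ+ →₀ ℕ) (k : ℕ+) :
    weight (d + Finsupp.single k 1) = (α * (k : ℕ)) * (d k + 1 : ℕ) * weight d := by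
  classical
  have h0 : ∀ i : ℕ+, (α * ((i : ℕ) : F)) ^ 0 * ((0 ! : ℕ) : F) = 1 := by simp
  have he : (d + Finsupp.single k 1).erase k = d.erase k := by
    ext j
    by_cases hj : j = k
    · subst hj; simp
    · simp [Finsupp.erase_ne hj]
  rw [weight, weight, ← Finsupp.mul_prod_erase' _ k _ h0, ← Finsupp.mul_prod_erase' d k _ h0, he]
  simp only [Finsupp.add_apply, Finsupp.single_eq_same, Nat.factorial_succ]
  push_cast
  ring

lemma jackInner_symm (f h : SymF) : jackInner f h = jackInner h f := by
  have key : jackInner = LinearMap.flip jackInner := by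
    refine (basisMonomials ℕ+ F).ext fun d => (basisMonomials ℕ+ F).ext fun e => ?_
    rw [LinearMap.flip_apply]
    simp only [coe_basisMonomials, jackInner_monomial, coeff_monomial]
    by_cases h : d = e
    · subst h; rfl
    · simp [h, Ne.symm h]
  exact LinearMap.congr_fun₂ key f h

/-- On monomials, raising the exponent of `p_{i+1}` from `e` to `e + 1` multiplies the weight by `α
(i+1) (e+1)`, the factor that the derivation produces when it lowers the exponent back. -/
lemma jackInner_pw_mul (i : ℕ) (f h : SymF) :
    jackInner (pw i * f) h = jackInner f (pd i h) := by
  have key : jackInner.compLeft (LinearMap.mulLeft F (pw i)) =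
      jackInner.compRight (pd i : SymF →ₗ[F] SymF) := by
    refine (basisMonomials ℕ+ F).ext fun d => (basisMonomials ℕ+ F).ext fun e => ?_
    simp only [coe_basisMonomials, LinearMap.BilinForm.compLeft_apply, LinearMap.mulLeft_apply,
      LinearMap.BilinForm.compRight_apply, pw, X, monomial_mul, one_mul, jackInner_monomial,
      Derivation.coeFn_coe, pd, Derivation.smul_apply, pderiv_monomial, coeff_smul,
      coeff_monomial]
    rw [add_comm (Finsupp.single _ _) d, weight_add_single]
    by_cases h : e = d + Finsupp.single i.succPNat 1
    · subst h
      simp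
      ring
    · rw [if_neg h]
      by_cases h0 : e i.succPNat = 0
      · simp [h0]
      · rw [if_neg]
        · simp
        · rintro rfl
          apply h
          rw [tsub_add_cancel_of_le]
          simpa using Nat.one_le_iff_ne_zero.2 h0
  exact LinearMap.congr_fun₂ key f h

lemma jackInner_pw_mul_right (i : ℕ) (f h : SymF) :
    jackInner f (pw i * h) = jackInner (pd i f) h := by
  rw [jackInner_symm, jackInner_pw_mul, jackInner_symm]

lemma jackInner_one (f : SymF) : jackInner f 1 = constantCoeff f := by
  rw [jackInner_symm, show (1 : SymF) = monomial 0 1 from rfl, jackInner_monomial, weight,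
    Finsupp.prod_zero_index, one_mul]
  rfl

lemma eq_zero_of_jackInner (h : SymF) (H : ∀ f, jackInner f h = 0) : h = 0 := by
  ext d
  have := H (monomial d 1)
  rw [jackInner_monomial] at this
  simpa using (mul_eq_zero.1 this).resolve_left (weight_ne_zero d)

/-! ### The generalized complete symmetric functions -/

/-- The function `g_n = ∑_{ρ ⊢ n} α ^ (-l(ρ)) z_ρ⁻¹ p_ρ`, given by its recursion. -/
def gh : ℕ → SymF
  | 0 => 1
  | n + 1 => (α * ((n : F) + 1))⁻¹ • ∑ i : Fin (n + 1), pw i * gh (n - i)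

lemma gh_zero : gh 0 = 1 := by rw [gh]

lemma gh_newton (n : ℕ) :
    (α * (n : F)) • gh n = ∑ i ∈ Finset.range n, pw i * gh (n - 1 - i) := by
  cases n with
  | zero => simp
  | succ n =>
    rw [gh, Nat.cast_succ, smul_inv_smul₀ (alpha_mul_succ_ne_zero n),
      Finset.sum_range fun i => pw i * gh (n + 1 - 1 - i)]
    rfl

lemma pd_pw (i j : ℕ) : pd i (pw j) = if i = j then C (α * ((i : F) + 1)) else 0 := by
  rw [pd, Derivation.smul_apply, pw, pderiv_X]
  by_cases h : i = j
  · subst h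
    simp [smul_eq_C_mul]
  · have : i.succPNat ≠ j.succPNat := fun e => h (Nat.succPNat_injective e)
    simp [h]

/-- Differentiate Newton's recursion for `g_{n+1}`. The term where `p_{i+1}` itself is
differentiated gives `α (i+1) g_{n-i}`; by induction the others form the recursion for `α (n-i)
g_{n-i}`. The total `α (n+1) g_{n-i}` matches the left side. -/
lemma pd_gh (i n : ℕ) : pd i (gh n) = if i < n then gh (n - 1 - i) else 0 := by
  induction n using Nat.strong_induction_on with
  | _ n ih =>
    cases n with
    | zero => simp [gh_zero]
    | succ n =>
      have h1 := congrArg (pd i) (gh_newton (n + 1))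
      have h2 : ∀ j ∈ Finset.range (n + 1), pd i (pw j * gh (n + 1 - 1 - j)) =
          (if i = j then (α * ((i : F) + 1)) • gh (n - i) else 0) +
            (if i < n - j then pw j * gh (n - i - 1 - j) else 0) := by
        intro j hj
        rw [Finset.mem_range] at hj
        rw [Derivation.leibniz, pd_pw, ih _ (by omega), add_comm]
        congr 1
        · by_cases h : i = j
          · subst h
            simp [smul_eq_C_mul, mul_comm]
          · simp [h]
        · rw [Nat.add_sub_cancel]
          by_cases h : i < n - j
          · rw [if_pos h, if_pos h, smul_eq_mul]
            congr 2
            omega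
          · rw [if_neg h, if_neg h, smul_zero]
      rw [Derivation.map_smul, map_sum, Finset.sum_congr rfl h2, Finset.sum_add_distrib, Finset.sum_ite_eq] at h1
      have hne := alpha_mul_succ_ne_zero n
      rw [Nat.cast_succ] at h1
      apply smul_right_injective SymF hne
      simp only
      rw [h1]
      by_cases h : i < n + 1
      · have h3 : ∑ j ∈ Finset.range (n + 1), (if i < n - j then pw j * gh (n - i - 1 - j) else 0) =
            (α * ((n - i : ℕ) : F)) • gh (n - i) := by
          rw [gh_newton, ← Finset.sum_filter]
          refine Finset.sum_congr ?_ fun _ _ => rfl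
          ext j
          simp only [Finset.mem_filter, Finset.mem_range]
          omega
        rw [if_pos (Finset.mem_range.2 h), if_pos h, h3, Nat.add_sub_cancel, ← add_smul,
          Nat.cast_sub (by omega)]
        congr 1
        ring
      · rw [if_neg (by simpa using h), if_neg h, smul_zero, zero_add]
        refine Finset.sum_eq_zero fun j hj => if_neg (by omega)

/-- The product of the `g_n` for `n` in a multiset. -/
def ghM (s : Multiset ℕ) : SymF := (s.map gh).prod

lemma ghM_zero : ghM 0 = 1 := by simp [ghM]

lemma ghM_cons (a : ℕ) (s : Multiset ℕ) : ghM (a ::ₘ s) = gh a * ghM s := by simp [ghM]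

lemma ghM_filter (s : Multiset ℕ) : ghM (s.filter (· ≠ 0)) = ghM s := by
  induction s using Multiset.induction_on with
  | empty => simp
  | cons a s ih =>
    by_cases ha : a = 0
    · simpa [ha, ghM_cons, gh_zero] using ih
    · rw [Multiset.filter_cons_of_pos (p := (· ≠ 0)) s ha, ghM_cons, ghM_cons, ih]

lemma span_ghM : Submodule.span F (Set.range ghM) = ⊤ := by
  set M := Submodule.span F (Set.range ghM)
  have hg : ∀ n, ∀ f ∈ M, gh n * f ∈ M := by
    intro n f hf
    induction hf using Submodule.span_induction with
    | mem x hx =>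
      obtain ⟨s, rfl⟩ := hx
      exact Submodule.subset_span ⟨n ::ₘ s, ghM_cons n s⟩
    | zero => simp
    | add x y _ _ hx hy => rw [mul_add]; exact M.add_mem hx hy
    | smul a x _ hx => rw [mul_smul_comm]; exact M.smul_mem a hx
  have hp : ∀ n, ∀ f ∈ M, pw n * f ∈ M := by
    intro n
    induction n using Nat.strong_induction_on with
    | _ n ih =>
      intro f hf
      have h1 := gh_newton (n + 1)
      rw [Finset.sum_range_succ, Nat.add_sub_cancel, Nat.sub_self, gh_zero, mul_one] at h1
      -- Newton's recursion solved for `p_{n+1}`, whose coefficient there is `g_0 = 1`.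
      rw [← sub_eq_iff_eq_add'.2 h1, sub_mul, Finset.sum_mul, smul_mul_assoc]
      refine M.sub_mem (M.smul_mem _ (hg _ _ hf)) (M.sum_mem fun i hi => ?_)
      rw [mul_assoc]
      exact ih i (Finset.mem_range.1 hi) _ (hg _ _ hf)
  rw [eq_top_iff]
  rintro f -
  induction f using MvPolynomial.induction_on with
  | C a =>
    rw [← mul_one (C a), ← smul_eq_C_mul]
    exact M.smul_mem a (Submodule.subset_span ⟨0, ghM_zero⟩)
  | add f h hf hh => exact M.add_mem hf hh
  | mul_X f k hf =>
    have := hp k.natPred f hf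
    rwa [pw, PNat.succPNat_natPred, mul_comm] at this

/-- Lets identities between symmetric functions be tested against products of the `g_n`, so that
injectivity of `realize` is not needed. -/
lemma eq_zero_of_jackInner_ghM (h : SymF) (H : ∀ s, jackInner (ghM s) h = 0) : h = 0 := by
  refine eq_zero_of_jackInner h fun f => ?_
  have hf : f ∈ Submodule.span F (Set.range ghM) := by rw [span_ghM]; trivial
  induction hf using Submodule.span_induction with
  | mem x hx => obtain ⟨s, rfl⟩ := hx; exact H s
  | zero => simp
  | add x y _ _ hx hy => rw [map_add, LinearMap.add_apply, hx, hy, add_zero]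
  | smul a x _ hx => rw [map_smul, LinearMap.smul_apply, hx, smul_zero]

/-! ### Orthogonality of different degrees -/

lemma gh_isWeightedHomogeneous (n : ℕ) : IsWeightedHomogeneous (fun k : ℕ+ => (k : ℕ)) (gh n) n := by
  induction n using Nat.strong_induction_on with
  | _ n ih =>
    cases n with
    | zero => rw [gh_zero]; exact isWeightedHomogeneous_one _ _
    | succ n =>
      rw [gh, smul_eq_C_mul]
      refine IsWeightedHomogeneous.C_mul (IsWeightedHomogeneous.sum _ _ _ fun i _ => ?_) _
      have h1 := isWeightedHomogeneous_X F (fun k : ℕ+ => (k : ℕ)) (i : ℕ).succPNat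
      have h2 := h1.mul (ih (n - i) (by omega))
      have h3 : (((i : ℕ).succPNat : ℕ+) : ℕ) + (n - i) = n + 1 := by
        rw [Nat.succPNat_coe]; omega
      rw [h3] at h2
      exact h2

lemma ghM_isWeightedHomogeneous (s : Multiset ℕ) :
    IsWeightedHomogeneous (fun k : ℕ+ => (k : ℕ)) (ghM s) s.sum := by
  induction s using Multiset.induction_on with
  | empty => rw [ghM_zero]; exact isWeightedHomogeneous_one _ _
  | cons a s ih =>
    rw [ghM_cons, Multiset.sum_cons]
    exact (gh_isWeightedHomogeneous a).mul ih

lemma jackInner_eq_zero_of_isWeightedHomogeneous {f h : SymF} {a b : ℕ}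
    (hf : IsWeightedHomogeneous (fun k : ℕ+ => (k : ℕ)) f a)
    (hh : IsWeightedHomogeneous (fun k : ℕ+ => (k : ℕ)) h b) (hab : a ≠ b) :
    jackInner f h = 0 := by
  rw [f.as_sum, map_sum, LinearMap.sum_apply]
  refine Finset.sum_eq_zero fun d hd => ?_
  have h1 : (monomial d (coeff d f)) = coeff d f • monomial d (1 : F) := by simp [smul_monomial]
  rw [h1, map_smul, LinearMap.smul_apply, jackInner_monomial]
  have h2 := hf (mem_support_iff.1 hd)
  rw [hh.coeff_eq_zero d (by rw [h2]; exact hab), mul_zero, smul_zero]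

lemma jackInner_ghM_ghM {s t : Multiset ℕ} (h : s.sum ≠ t.sum) :
    jackInner (ghM s) (ghM t) = 0 :=
  jackInner_eq_zero_of_isWeightedHomogeneous (ghM_isWeightedHomogeneous s)
    (ghM_isWeightedHomogeneous t) h

/-! ### The products of the `g_n` are dual to the monomial symmetric functions -/

/-- Since `g_0 = 1`, zero exponents are harmless; a fixed index set can thus be kept after an
exponent has been lowered to zero. -/
lemma ghM_finsupp (d : ℕ →₀ ℕ) (s : Finset ℕ) (hs : d.support ⊆ s) :
    ghM (d.support.val.map d) = ∏ i ∈ s, gh (d i) := by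
  rw [ghM, Multiset.map_map, ← Finset.prod_subset hs]
  · rfl
  · intro i _ hi
    rw [Finsupp.notMem_support_iff.1 hi, gh_zero]

lemma pd_prod {ι : Type*} [DecidableEq ι] (i : ℕ) (s : Finset ι) (f : ι → SymF) :
    pd i (∏ j ∈ s, f j) = ∑ j ∈ s, (∏ l ∈ s.erase j, f l) * pd i (f j) := by
  induction s using Finset.induction_on with
  | empty => simp
  | insert a s ha ih =>
    rw [Finset.prod_insert ha, Derivation.leibniz, ih, Finset.sum_insert ha,
      Finset.erase_insert ha, smul_eq_mul, smul_eq_mul, Finset.mul_sum, add_comm]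
    congr 1
    refine Finset.sum_congr rfl fun j hj => ?_
    have hja : j ≠ a := fun e => ha (e ▸ hj)
    rw [Finset.erase_insert_of_ne hja.symm, Finset.prod_insert (fun h => ha (Finset.mem_of_mem_erase h)),
      mul_assoc]

lemma pd_ghM_finsupp (k : ℕ) (d : ℕ →₀ ℕ) :
    pd k (ghM (d.support.val.map d)) = ∑ i ∈ d.support with k < d i,
      ghM ((d - Finsupp.single i (k + 1)).support.val.map (d - Finsupp.single i (k + 1))) := by
  classical
  rw [ghM_finsupp d _ subset_rfl, pd_prod, Finset.sum_filter]
  refine Finset.sum_congr rfl fun i hi => ?_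
  rw [pd_gh]
  by_cases h : k < d i
  · rw [if_pos h, if_pos h, ghM_finsupp _ d.support, ← Finset.prod_erase_mul _ _ hi]
    · congr 1
      · refine Finset.prod_congr rfl fun j hj => ?_
        rw [Finsupp.tsub_apply, Finsupp.single_eq_of_ne (Finset.ne_of_mem_erase hj), Nat.sub_zero]
      · rw [Finsupp.tsub_apply, Finsupp.single_eq_same, Nat.sub_sub, add_comm 1]
    · intro j hj
      rw [Finsupp.mem_support_iff, Finsupp.tsub_apply] at hj
      rw [Finsupp.mem_support_iff]
      omega
  · rw [if_neg h, if_neg h, mul_zero]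

lemma coeff_powerSumSeries_mul (k : ℕ) (R : MvPowerSeries ℕ F) (d : ℕ →₀ ℕ) :
    MvPowerSeries.coeff d (powerSumSeries (k + 1) * R) = ∑ i ∈ d.support with k < d i,
      MvPowerSeries.coeff (d - Finsupp.single i (k + 1)) R := by
  classical
  have hc : ∀ e : ℕ →₀ ℕ, MvPowerSeries.coeff e (powerSumSeries (k + 1)) =
      if ∃ i, e = Finsupp.single i (k + 1) then (1 : F) else 0 := by
    intro e
    rw [MvPowerSeries.coeff_apply, powerSumSeries]
  rw [MvPowerSeries.coeff_mul]
  simp only [hc, ite_mul, one_mul, zero_mul]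
  rw [← Finset.sum_filter]
  symm
  refine Finset.sum_bij (fun i _ => (Finsupp.single i (k + 1), d - Finsupp.single i (k + 1)))
    ?_ ?_ ?_ ?_
  · intro i hi
    simp only [Finset.mem_filter, Finsupp.mem_support_iff] at hi
    refine Finset.mem_filter.2 ⟨Finset.HasAntidiagonal.mem_antidiagonal.2 (add_tsub_cancel_of_le ?_), i, rfl⟩
    rw [Finsupp.single_le_iff]
    exact hi.2
  · intro i _ j _ h
    exact Finsupp.single_left_injective (Nat.succ_ne_zero k) (Prod.ext_iff.1 h).1
  · rintro ⟨a, b⟩ h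
    obtain ⟨h1, i, h2⟩ := Finset.mem_filter.1 h
    replace h1 := Finset.HasAntidiagonal.mem_antidiagonal.1 h1
    simp only at h1 h2
    subst h1 h2
    refine ⟨i, ?_, ?_⟩
    · simp
      omega
    · simp
  · intro i _
    rfl

lemma realize_pw (k : ℕ) : realize (pw k) = powerSumSeries (k + 1) := by
  rw [realize, pw, aeval_X, Nat.succPNat_coe]

/-- The coefficient of a monomial in a symmetric function is its scalar product with the
corresponding product of the `g_n`. -/
theorem coeff_realize (h : SymF) (d : ℕ →₀ ℕ) :
    MvPowerSeries.coeff d (realize h) = jackInner (ghM (d.support.val.map d)) h := by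
  induction h using MvPolynomial.induction_on generalizing d with
  | C a =>
    have h1 : (C a : SymF) = a • 1 := by rw [smul_eq_C_mul, mul_one]
    -- A constant pairs with `g_d` through the constant term, which vanishes as soon as one exponent
    -- is positive.
    have h2 : ∀ n, constantCoeff (gh n) = if n = 0 then (1 : F) else 0 := by
      intro n
      cases n with
      | zero => simp [gh_zero]
      | succ n =>
        rw [gh, smul_eq_C_mul, map_mul, map_sum, if_neg (Nat.succ_ne_zero n)]
        simp [pw]
    rw [h1, map_smul, map_smul, map_one, map_smul, jackInner_one, ghM_finsupp d _ subset_rfl,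
      map_prod]
    congr 1
    classical
    rw [MvPowerSeries.coeff_one]
    by_cases hd : d = 0
    · simp [hd]
    · rw [if_neg hd]
      obtain ⟨i, hi⟩ := Finsupp.support_nonempty_iff.2 hd
      refine (Finset.prod_eq_zero hi ?_).symm
      rw [h2, if_neg (Finsupp.mem_support_iff.1 hi)]
  | add f h hf hh => rw [map_add, map_add, map_add, hf, hh]
  | mul_X f k hf =>
    have h1 : (X k : SymF) = pw k.natPred := by rw [pw, PNat.succPNat_natPred]
    -- Both sides obey the same recursion: multiplication by `p_k` sums over all ways of lowering
    -- one exponent by `k`, for coefficients directly and for scalar products after passing to the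
    -- adjoint.
    rw [h1, mul_comm, map_mul, realize_pw, coeff_powerSumSeries_mul, jackInner_pw_mul_right,
      pd_ghM_finsupp, map_sum, LinearMap.sum_apply]
    exact Finset.sum_congr rfl fun i _ => hf _

/-! ### The Laplace–Beltrami operator -/

/-- The Laplace–Beltrami operator, truncated to the power sums `p_1, …, p_{2N}`. -/
def lbOp (N : ℕ) : SymF →ₗ[F] SymF :=
  (2 * α)⁻¹ • ∑ i ∈ Finset.range N, ∑ j ∈ Finset.range N,
      (LinearMap.mulLeft F (pw (i + j + 1)) ∘ₗ (pd i : SymF →ₗ[F] SymF) ∘ₗ (pd j : SymF →ₗ[F] SymF) +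
        LinearMap.mulLeft F (pw i) ∘ₗ LinearMap.mulLeft F (pw j) ∘ₗ
          (pd (i + j + 1) : SymF →ₗ[F] SymF)) +
    ∑ i ∈ Finset.range N, (((α - 1) * ((i : F) + 1) - 1) / (2 * α)) •
      (LinearMap.mulLeft F (pw i) ∘ₗ (pd i : SymF →ₗ[F] SymF))

lemma lbOp_apply (N : ℕ) (f : SymF) :
    lbOp N f = (2 * α)⁻¹ • (∑ i ∈ Finset.range N, ∑ j ∈ Finset.range N,
        pw (i + j + 1) * pd i (pd j f) +
          ∑ i ∈ Finset.range N, ∑ j ∈ Finset.range N, pw i * (pw j * pd (i + j + 1) f)) +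
      ∑ i ∈ Finset.range N, (((α - 1) * ((i : F) + 1) - 1) / (2 * α)) • (pw i * pd i f) := by
  simp only [lbOp, LinearMap.add_apply, LinearMap.smul_apply, LinearMap.sum_apply,
    LinearMap.comp_apply, LinearMap.mulLeft_apply, Derivation.coeFn_coe, Finset.sum_add_distrib]

/-- Dual to the commutativity of multiplication by power sums. -/
lemma pd_comm (i j : ℕ) (f : SymF) : pd i (pd j f) = pd j (pd i f) := by
  refine sub_eq_zero.1 (eq_zero_of_jackInner _ fun h => ?_)
  rw [map_sub, ← jackInner_pw_mul, ← jackInner_pw_mul, ← jackInner_pw_mul, ← jackInner_pw_mul,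
    mul_left_comm, sub_self]

/-- The terms merging two power sums and those splitting one are adjoint to each other, and the
diagonal terms are self-adjoint. Truncation does no harm because both double sums run over the same
square of indices. -/
theorem jackInner_lbOp (N : ℕ) (f h : SymF) :
    jackInner (lbOp N f) h = jackInner f (lbOp N h) := by
  have h1 : ∀ i j : ℕ, jackInner (pw (i + j + 1) * pd i (pd j f)) h =
      jackInner f (pw i * (pw j * pd (i + j + 1) h)) := by
    intro i j
    rw [jackInner_pw_mul, jackInner_pw_mul_right, jackInner_pw_mul_right, pd_comm]
  have h2 : ∀ i j : ℕ, jackInner (pw i * (pw j * pd (i + j + 1) f)) h =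
      jackInner f (pw (i + j + 1) * pd i (pd j h)) := by
    intro i j
    rw [jackInner_pw_mul, jackInner_pw_mul, jackInner_pw_mul_right, pd_comm]
  have h3 : ∀ i : ℕ, jackInner (pw i * pd i f) h = jackInner f (pw i * pd i h) := by
    intro i
    rw [jackInner_pw_mul, jackInner_pw_mul_right]
  rw [lbOp_apply, lbOp_apply]
  simp only [map_add, map_smul, LinearMap.add_apply, LinearMap.smul_apply, map_sum,
    LinearMap.sum_apply, h1, h2, h3]
  rw [add_comm (∑ i ∈ Finset.range N, ∑ j ∈ Finset.range N, jackInner f (pw i * _))]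

/-- The bilinear form `(f, h) ↦ D(f h) - f D(h) - h D(f)` measuring by how much the
Laplace–Beltrami operator `D` fails to be a derivation. -/
def carre (N : ℕ) (f h : SymF) : SymF :=
  α⁻¹ • ∑ i ∈ Finset.range N, ∑ j ∈ Finset.range N, pw (i + j + 1) * (pd i f * pd j h)

lemma carre_comm (N : ℕ) (f h : SymF) : carre N f h = carre N h f := by
  rw [carre, carre, Finset.sum_comm]
  refine congrArg (α⁻¹ • ·) ?_
  refine Finset.sum_congr rfl fun i _ => Finset.sum_congr rfl fun j _ => ?_
  rw [add_comm j i, mul_comm (pd j f)]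

lemma carre_one (N : ℕ) (f : SymF) : carre N f 1 = 0 := by
  simp [carre]

/-- Only the merging part of the operator has second order, so its defect from being a derivation is
itself a derivation in each argument. -/
lemma carre_mul (N : ℕ) (f h k : SymF) :
    carre N f (h * k) = carre N f h * k + carre N f k * h := by
  simp only [carre, smul_mul_assoc, ← smul_add, Finset.sum_mul, ← Finset.sum_add_distrib]
  refine congrArg (α⁻¹ • ·) ?_
  refine Finset.sum_congr rfl fun i _ => Finset.sum_congr rfl fun j _ => ?_
  rw [Derivation.leibniz, smul_eq_mul, smul_eq_mul]
  ring

lemma lbOp_one (N : ℕ) : lbOp N 1 = 0 := by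
  simp [lbOp_apply]

lemma lbOp_mul (N : ℕ) (f h : SymF) :
    lbOp N (f * h) = lbOp N f * h + lbOp N h * f + carre N f h := by
  have h1 : ∑ i ∈ Finset.range N, ∑ j ∈ Finset.range N, pw (i + j + 1) * pd i (pd j (f * h)) =
      (∑ i ∈ Finset.range N, ∑ j ∈ Finset.range N, pw (i + j + 1) * pd i (pd j f)) * h +
        (∑ i ∈ Finset.range N, ∑ j ∈ Finset.range N, pw (i + j + 1) * pd i (pd j h)) * f +
        (∑ i ∈ Finset.range N, ∑ j ∈ Finset.range N, pw (i + j + 1) * (pd i f * pd j h) +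
        ∑ i ∈ Finset.range N, ∑ j ∈ Finset.range N, pw (i + j + 1) * (pd i f * pd j h)) := by
    -- The product rule yields two cross terms that differ by exchanging `i` and `j`; together they
    -- turn the factor `1 / (2 α)` into `1 / α`.
    conv_rhs => rw [Finset.sum_comm (f := fun i j => pw (i + j + 1) * (pd i f * pd j h))]
    conv_rhs => enter [2, 2]; rw [Finset.sum_comm]
    simp only [Finset.sum_mul, ← Finset.sum_add_distrib]
    refine Finset.sum_congr rfl fun i _ => Finset.sum_congr rfl fun j _ => ?_
    simp only [Derivation.leibniz, smul_eq_mul, map_add]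
    rw [add_comm j i]
    ring
  have h2 : ∑ i ∈ Finset.range N, ∑ j ∈ Finset.range N, pw i * (pw j * pd (i + j + 1) (f * h)) =
      (∑ i ∈ Finset.range N, ∑ j ∈ Finset.range N, pw i * (pw j * pd (i + j + 1) f)) * h +
      (∑ i ∈ Finset.range N, ∑ j ∈ Finset.range N, pw i * (pw j * pd (i + j + 1) h)) * f := by
    simp only [Finset.sum_mul, ← Finset.sum_add_distrib]
    refine Finset.sum_congr rfl fun i _ => Finset.sum_congr rfl fun j _ => ?_
    simp only [Derivation.leibniz, smul_eq_mul]
    ring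
  have h3 : ∀ c : ℕ → F, ∑ i ∈ Finset.range N, c i • (pw i * pd i (f * h)) =
      (∑ i ∈ Finset.range N, c i • (pw i * pd i f)) * h +
      (∑ i ∈ Finset.range N, c i • (pw i * pd i h)) * f := by
    intro c
    simp only [Finset.sum_mul, ← Finset.sum_add_distrib, smul_eq_C_mul, Derivation.leibniz,
      smul_eq_mul]
    refine Finset.sum_congr rfl fun i _ => ?_
    ring
  have h4 : (2 * α : F)⁻¹ + (2 * α)⁻¹ = α⁻¹ := by
    have := alpha_ne_zero
    field_simp
    norm_num
  rw [lbOp_apply, lbOp_apply, lbOp_apply, h1, h2, h3, carre, ← h4]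
  generalize (∑ i ∈ Finset.range N, ∑ j ∈ Finset.range N, pw (i + j + 1) * (pd i f * pd j h)) = s
  simp only [add_smul, smul_add, smul_eq_C_mul]
  ring

lemma carre_prod {ι : Type*} [DecidableEq ι] (N : ℕ) (h : SymF) (s : Finset ι) (f : ι → SymF) :
    carre N h (∏ i ∈ s, f i) = ∑ i ∈ s, carre N h (f i) * ∏ j ∈ s.erase i, f j := by
  induction s using Finset.induction_on with
  | empty => simp [carre_one]
  | insert a s ha ih =>
    rw [Finset.prod_insert ha, carre_mul, ih, Finset.sum_insert ha, Finset.erase_insert ha,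
      Finset.sum_mul]
    congr 1
    refine Finset.sum_congr rfl fun i hi => ?_
    have hia : i ≠ a := fun e => ha (e ▸ hi)
    rw [Finset.erase_insert_of_ne hia.symm,
      Finset.prod_insert (fun h => ha (Finset.mem_of_mem_erase h)), mul_assoc, mul_comm (f a)]

/-- An operator of order two sees at most two factors at a time. Adjoining a maximal index makes it
the larger member of every new pair. -/
lemma lbOp_prod {ι : Type*} [LinearOrder ι] (N : ℕ) (s : Finset ι) (f : ι → SymF) :
    lbOp N (∏ i ∈ s, f i) = ∑ i ∈ s, lbOp N (f i) * ∏ l ∈ s.erase i, f l +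
      ∑ j ∈ s, ∑ i ∈ s with i < j, carre N (f i) (f j) * ∏ l ∈ (s.erase i).erase j, f l := by
  induction s using Finset.induction_on_max with
  | empty => simp [lbOp_one]
  | insert a s hs ih =>
    have ha : a ∉ s := fun h => lt_irrefl _ (hs a h)
    have e1 : ∀ i ∈ s, ∏ l ∈ (insert a s).erase i, f l = f a * ∏ l ∈ s.erase i, f l := by
      intro i hi
      rw [Finset.erase_insert_of_ne (hs i hi).ne',
        Finset.prod_insert (fun h => ha (Finset.mem_of_mem_erase h))]
    rw [Finset.prod_insert ha, lbOp_mul, ih, carre_prod, Finset.sum_insert ha,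
      Finset.sum_insert ha, Finset.erase_insert ha]
    have f1 : (insert a s).filter (· < a) = s := by
      rw [Finset.filter_insert, if_neg (lt_irrefl a), Finset.filter_true_of_mem hs]
    have f2 : ∀ j ∈ s, (insert a s).filter (· < j) = s.filter (· < j) := by
      intro j hj
      rw [Finset.filter_insert, if_neg (hs j hj).not_gt]
    have g1 : ∑ i ∈ s, lbOp N (f i) * ∏ l ∈ (insert a s).erase i, f l =
        (∑ i ∈ s, lbOp N (f i) * ∏ l ∈ s.erase i, f l) * f a := by
      rw [Finset.sum_mul]
      refine Finset.sum_congr rfl fun i hi => ?_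
      rw [e1 i hi]
      ring
    have g2 : ∑ i ∈ s, carre N (f i) (f a) * ∏ l ∈ ((insert a s).erase i).erase a, f l =
        ∑ i ∈ s, carre N (f a) (f i) * ∏ l ∈ s.erase i, f l := by
      refine Finset.sum_congr rfl fun i hi => ?_
      rw [Finset.erase_right_comm, Finset.erase_insert ha, carre_comm]
    have g3 : ∑ j ∈ s, ∑ i ∈ insert a s with i < j,
          carre N (f i) (f j) * ∏ l ∈ ((insert a s).erase i).erase j, f l =
        (∑ j ∈ s, ∑ i ∈ s with i < j,
          carre N (f i) (f j) * ∏ l ∈ (s.erase i).erase j, f l) * f a := by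
      rw [Finset.sum_mul]
      refine Finset.sum_congr rfl fun j hj => ?_
      rw [f2 j hj, Finset.sum_mul]
      refine Finset.sum_congr rfl fun i hi => ?_
      rw [Finset.mem_filter] at hi
      rw [Finset.erase_insert_of_ne (hs i hi.1).ne', Finset.erase_insert_of_ne (hs j hj).ne',
        Finset.prod_insert (fun h => ha (Finset.mem_of_mem_erase (Finset.mem_of_mem_erase h)))]
      ring
    rw [g1, g3, f1, g2]
    ring

/-! ### Its action on products of the `g_n` -/

lemma sum_mul_pd_gh {n N : ℕ} (h : n ≤ N) (c : ℕ → SymF) :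
    ∑ i ∈ Finset.range N, c i * pd i (gh n) = ∑ i ∈ Finset.range n, c i * gh (n - 1 - i) := by
  rw [← Finset.sum_subset (Finset.range_subset_range.2 h)]
  · refine Finset.sum_congr rfl fun i hi => ?_
    rw [pd_gh, if_pos (Finset.mem_range.1 hi)]
  · intro i _ hi
    rw [pd_gh, if_neg (by simpa using hi), mul_zero]

lemma pd_pd_gh (i j n : ℕ) : pd j (pd i (gh n)) = pd (i + j + 1) (gh n) := by
  rw [pd_gh, pd_gh]
  by_cases h : i < n
  · rw [if_pos h, pd_gh]
    by_cases h' : i + j + 1 < n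
    · rw [if_pos (by omega), if_pos h']
      congr 1
      omega
    · rw [if_neg (by omega), if_neg h']
  · rw [if_neg h, if_neg (by omega), map_zero]

/-- There are exactly `m` pairs `(i, j)` with `i + j + 1 = m`. -/
lemma sum_sum_add_one {n N : ℕ} (h : n ≤ N) (c : ℕ → SymF) (hc : ∀ m, n ≤ m → c m = 0) :
    ∑ i ∈ Finset.range N, ∑ j ∈ Finset.range N, c (i + j + 1) =
      ∑ m ∈ Finset.range n, (m : F) • c m := by
  have h1 : ∀ i ∈ Finset.range N, ∑ j ∈ Finset.range N, c (i + j + 1) =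
      ∑ m ∈ Finset.range n, if i < m then c m else 0 := by
    intro i _
    rw [← Finset.sum_filter]
    have h2 := Finset.sum_Ico_eq_sum_range c (i + 1) (i + 1 + N)
    rw [Nat.add_sub_cancel_left] at h2
    rw [Finset.sum_congr rfl fun j _ => by rw [add_right_comm], ← h2]
    symm
    refine Finset.sum_subset ?_ ?_
    · intro m hm
      simp only [Finset.mem_filter, Finset.mem_range] at hm
      rw [Finset.mem_Ico]
      omega
    · intro m hm hm'
      simp only [Finset.mem_filter, Finset.mem_range] at hm'
      rw [Finset.mem_Ico] at hm
      exact hc m (by omega)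
  rw [Finset.sum_congr rfl h1, Finset.sum_comm]
  refine Finset.sum_congr rfl fun m hm => ?_
  rw [Finset.mem_range] at hm
  have h3 : (Finset.range N).filter (· < m) = Finset.range m := by
    ext i
    simp only [Finset.mem_filter, Finset.mem_range]
    omega
  rw [← Finset.sum_filter, h3, Finset.sum_const, Finset.card_range, Nat.cast_smul_eq_nsmul]

/-- All three parts of the operator reduce to sums of `p_{m+1} g_{n-1-m}`. The coefficients add up
to `n / 2 - 1 / α`, independently of `m`, so Newton's recursion sums them to a multiple of `g_n`.
The bound `n ≤ N` makes the truncation invisible. -/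
lemma lbOp_gh {n N : ℕ} (h : n ≤ N) :
    lbOp N (gh n) = (α / 2 * (n : F) ^ 2 - n) • gh n := by
  have hα := alpha_ne_zero
  have h1 : ∑ i ∈ Finset.range N, ∑ j ∈ Finset.range N, pw (i + j + 1) * pd i (pd j (gh n)) =
      ∑ m ∈ Finset.range n, (m : F) • (pw m * gh (n - 1 - m)) := by
    have := sum_sum_add_one h (fun m => pw m * pd m (gh n)) fun m hm => by
      rw [pd_gh, if_neg (by omega), mul_zero]
    rw [Finset.sum_congr rfl fun i _ => Finset.sum_congr rfl fun j _ => by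
      rw [pd_comm, pd_pd_gh], this]
    refine Finset.sum_congr rfl fun i hi => ?_
    rw [pd_gh, if_pos (Finset.mem_range.1 hi)]
  have h2 : ∑ i ∈ Finset.range N, ∑ j ∈ Finset.range N, pw i * (pw j * pd (i + j + 1) (gh n)) =
      ∑ i ∈ Finset.range n, (α * ((n : F) - 1 - i)) • (pw i * gh (n - 1 - i)) := by
    rw [← Finset.sum_subset (Finset.range_subset_range.2 h)]
    · refine Finset.sum_congr rfl fun i hi => ?_
      rw [Finset.mem_range] at hi
      have h3 : ∀ j, pd (i + j + 1) (gh n) = pd j (gh (n - 1 - i)) := by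
        intro j
        rw [← pd_pd_gh, pd_gh i, if_pos hi]
      simp only [h3]
      rw [← Finset.mul_sum, sum_mul_pd_gh (by omega), ← gh_newton, mul_smul_comm,
        Nat.cast_sub (by omega), Nat.cast_sub (by omega), Nat.cast_one]
    · intro i _ hi
      refine Finset.sum_eq_zero fun j _ => ?_
      rw [Finset.mem_range] at hi
      rw [pd_gh, if_neg (by omega), mul_zero, mul_zero]
  have h3 : ∑ i ∈ Finset.range N, (((α - 1) * ((i : F) + 1) - 1) / (2 * α)) • (pw i * pd i (gh n)) =
      ∑ i ∈ Finset.range n, (((α - 1) * ((i : F) + 1) - 1) / (2 * α)) • (pw i * gh (n - 1 - i)) := by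
    have := sum_mul_pd_gh h fun i => C (((α - 1) * ((i : F) + 1) - 1) / (2 * α)) * pw i
    simpa only [smul_eq_C_mul, mul_assoc] using this
  have h4 : (α / 2 * (n : F) ^ 2 - n) • gh n =
      ((n : F) / 2 - 1 / α) • ((α * (n : F)) • gh n) := by
    rw [smul_smul]
    congr 1
    field_simp
  rw [lbOp_apply, h1, h2, h3, h4, gh_newton, ← Finset.sum_add_distrib, Finset.smul_sum,
    ← Finset.sum_add_distrib, Finset.smul_sum]
  refine Finset.sum_congr rfl fun i _ => ?_
  rw [← add_smul, smul_smul, ← add_smul]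
  congr 1
  field_simp
  ring

/-- `α` times the value of `carre` at `g_a` and `g_b`. -/
def carreSum (a b : ℕ) : SymF :=
  ∑ i ∈ Finset.range a, ∑ j ∈ Finset.range b, pw (i + j + 1) * (gh (a - 1 - i) * gh (b - 1 - j))

lemma gh_newton_succ (n : ℕ) :
    (α * ((n : F) + 1)) • gh (n + 1) =
      ∑ i ∈ Finset.range n, pw (i + 1) * gh (n - 1 - i) + pw 0 * gh n := by
  have := gh_newton (n + 1)
  rw [Finset.sum_range_succ', Nat.cast_succ] at this
  rw [this]
  congr 1
  refine Finset.sum_congr rfl fun i _ => ?_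
  congr 2
  omega

/-- The terms `(i, j+1)` on the left and `(i+1, j)` on the right coincide. The remaining edges `j =
0` and `i = 0` are Newton sums lacking their `p_1` terms, and these missing terms cancel in the
difference. -/
lemma carreSum_succ (a b : ℕ) :
    carreSum a (b + 1) = carreSum (a + 1) b + (α * ((a : F) + 1)) • (gh (a + 1) * gh b) -
      (α * ((b : F) + 1)) • (gh a * gh (b + 1)) := by
  rw [← smul_mul_assoc, ← mul_smul_comm, gh_newton_succ, gh_newton_succ, carreSum, carreSum,
    Finset.sum_range_succ']
  simp only [Finset.sum_range_succ' _ b, Finset.sum_add_distrib]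
  have h2 : ∀ i j : ℕ, i + 1 + j + 1 = i + (j + 1) + 1 := fun i j => by omega
  simp only [h2, Nat.add_sub_cancel, Nat.sub_zero, zero_add, add_zero]
  have h3 : ∑ i ∈ Finset.range a, pw (i + 1) * (gh (a - 1 - i) * gh b) =
      (∑ i ∈ Finset.range a, pw (i + 1) * gh (a - 1 - i)) * gh b := by
    rw [Finset.sum_mul]
    exact Finset.sum_congr rfl fun i _ => by ring
  have h4 : ∑ j ∈ Finset.range b, pw (j + 1) * (gh a * gh (b - 1 - j)) =
      gh a * (∑ j ∈ Finset.range b, pw (j + 1) * gh (b - 1 - j)) := by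
    rw [Finset.mul_sum]
    exact Finset.sum_congr rfl fun i _ => by ring
  have h5 : ∑ i ∈ Finset.range a, ∑ j ∈ Finset.range b,
        pw (i + (j + 1) + 1) * (gh (a - 1 - i) * gh (b - (j + 1))) =
      ∑ i ∈ Finset.range a, ∑ j ∈ Finset.range b,
        pw (i + (j + 1) + 1) * (gh (a - (i + 1)) * gh (b - 1 - j)) := by
    refine Finset.sum_congr rfl fun i _ => Finset.sum_congr rfl fun j _ => ?_
    rw [Nat.sub_sub, Nat.sub_sub, add_comm 1, add_comm 1]
  rw [h3, h4, h5]
  ring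

/-- Iterating `carreSum_succ` shifts units from `b` to `a` until `b = 0`. No order between `a` and
`b` is assumed. -/
lemma carreSum_eq (a b : ℕ) :
    α⁻¹ • carreSum a b = -(b : F) • (gh a * gh b) + ∑ k ∈ Finset.range b,
      ((a : F) - b + 2 * ((k : F) + 1)) • (gh (a + (k + 1)) * gh (b - (k + 1))) := by
  have hα := alpha_ne_zero
  induction b generalizing a with
  | zero => simp [carreSum]
  | succ b ih =>
    rw [carreSum_succ, smul_sub, smul_add, ih, smul_smul, smul_smul, inv_mul_cancel_left₀ hα,
      inv_mul_cancel_left₀ hα, Finset.sum_range_succ']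
    have h1 : ∀ k ∈ Finset.range b, (((a + 1 : ℕ) : F) - b + 2 * ((k : F) + 1)) •
          (gh (a + 1 + (k + 1)) * gh (b - (k + 1))) =
        ((a : F) - (b + 1 : ℕ) + 2 * (((k + 1 : ℕ) : F) + 1)) •
          (gh (a + (k + 1 + 1)) * gh (b + 1 - (k + 1 + 1))) := by
      intro k _
      rw [show a + 1 + (k + 1) = a + (k + 1 + 1) by omega,
        show b + 1 - (k + 1 + 1) = b - (k + 1) by omega]
      congr 1
      push_cast
      ring
    rw [Finset.sum_congr rfl h1, show b + 1 - (0 + 1) = b by omega, zero_add]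
    have h2 : ((a : F) - (b + 1 : ℕ) + 2 * (((0 : ℕ) : F) + 1)) • (gh (a + 1) * gh b) =
        -(b : F) • (gh (a + 1) * gh b) + ((a : F) + 1) • (gh (a + 1) * gh b) := by
      rw [← add_smul]
      congr 1
      push_cast
      ring
    rw [h2, Nat.cast_succ, neg_smul ((b : F) + 1)]
    abel

lemma carre_gh {a b N : ℕ} (ha : a ≤ N) (hb : b ≤ N) :
    carre N (gh a) (gh b) = -(b : F) • (gh a * gh b) + ∑ k ∈ Finset.range b,
      ((a : F) - b + 2 * ((k : F) + 1)) • (gh (a + (k + 1)) * gh (b - (k + 1))) := by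
  rw [← carreSum_eq, carre, carreSum]
  congr 1
  have h1 : ∀ i ∈ Finset.range N,
      ∑ j ∈ Finset.range N, pw (i + j + 1) * (pd i (gh a) * pd j (gh b)) =
        (∑ j ∈ Finset.range b, pw (i + j + 1) * gh (b - 1 - j)) * pd i (gh a) := by
    intro i _
    rw [← sum_mul_pd_gh hb, Finset.sum_mul]
    exact Finset.sum_congr rfl fun j _ => by ring
  rw [Finset.sum_congr rfl h1, sum_mul_pd_gh ha]
  refine Finset.sum_congr rfl fun i _ => ?_
  rw [Finset.sum_mul]
  exact Finset.sum_congr rfl fun j _ => by ring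

/-! ### Rows of partitions -/

lemma map_getD_range (l : List ℕ) :
    (Finset.range l.length).val.map (fun i => l.getD i 0) = (l : Multiset ℕ) := by
  rw [Finset.range_val, Multiset.range, Multiset.map_coe]
  congr 1
  refine List.ext_getElem (by simp) fun i h1 h2 => ?_
  rw [List.getElem_map, List.getElem_range, List.getD_eq_getElem _ _ h2]

lemma sum_take_eq (l : List ℕ) (t : ℕ) :
    (l.take t).sum = ∑ x ∈ Finset.range t, l.getD x 0 := by
  induction l generalizing t with
  | nil => simp
  | cons a l ih =>
    cases t with
    | zero => simp
    | succ t =>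
      rw [List.take_succ_cons, List.sum_cons, ih, Finset.sum_range_succ', add_comm]
      simp

lemma rows_sum {n : ℕ} (lam : n.Partition) : (rows lam).sum = n := by
  rw [← Multiset.sum_coe, rows_coe, lam.parts_sum]

lemma rows_pairwise {n : ℕ} (lam : n.Partition) : (rows lam).Pairwise (· ≥ ·) :=
  Multiset.pairwise_sort _ _

lemma rows_injective {n : ℕ} {lam mu : n.Partition} (h : rows lam = rows mu) : lam = mu := by
  apply Nat.Partition.ext
  rw [← rows_coe, ← rows_coe, h]

lemma lt_length_of_getD_pos {l : List ℕ} {i : ℕ} (h : 0 < l.getD i 0) : i < l.length := by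
  by_contra hcon
  rw [List.getD_eq_default _ _ (not_lt.1 hcon)] at h
  exact lt_irrefl _ h

lemma mult_eq_sum {n : ℕ} (a : ℕ) (lam : n.Partition) :
    (mult a lam : F) =
      ∑ i ∈ Finset.range (rows lam).length, if (rows lam).getD i 0 = a then 1 else 0 := by
  rw [mult, ← rows_coe, ← map_getD_range, Multiset.count_map, Finset.sum_boole]
  simp only [eq_comm (a := a)]
  rfl

/-! ### The dominance order -/

lemma DomLE.refl {n : ℕ} (lam : n.Partition) : DomLE lam lam := fun _ => le_rfl

lemma DomLE.trans {n : ℕ} {lam mu nu : n.Partition} (h : DomLE lam mu) (h' : DomLE mu nu) :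
    DomLE lam nu := fun i => (h i).trans (h' i)

lemma eq_of_sum_take_eq {n : ℕ} {lam mu : n.Partition}
    (h : ∀ t, ((rows lam).take t).sum = ((rows mu).take t).sum) : lam = mu := by
  have h1 : ∀ x, (rows lam).getD x 0 = (rows mu).getD x 0 := by
    intro x
    have e1 := h x
    have e2 := h (x + 1)
    simp only [sum_take_eq, Finset.sum_range_succ] at e1 e2
    omega
  have h2 : ∀ nu : n.Partition, ∀ x, x < (rows nu).length ↔ 0 < (rows nu).getD x 0 := by
    refine fun nu x => ⟨fun hx => ?_, lt_length_of_getD_pos⟩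
    rw [List.getD_eq_getElem _ _ hx]
    apply nu.parts_pos
    rw [← rows_coe, Multiset.mem_coe]
    exact List.getElem_mem hx
  apply rows_injective
  have hl : (rows lam).length = (rows mu).length := by
    have a1 := h2 lam (rows mu).length
    have a2 := h2 mu (rows lam).length
    have b1 := h2 lam (rows lam).length
    have b2 := h2 mu (rows mu).length
    rw [h1] at a1 b1
    by_contra hne
    rcases lt_or_gt_of_ne hne with hlt | hlt
    · exact lt_irrefl _ (b1.2 (a2.1 hlt))
    · exact lt_irrefl _ (b2.2 (a1.1 hlt))
  refine List.ext_getElem hl fun x hx hx' => ?_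
  rw [← List.getD_eq_getElem _ 0 hx, ← List.getD_eq_getElem _ 0 hx', h1]

lemma DomLE.antisymm {n : ℕ} {lam mu : n.Partition} (h : DomLE lam mu) (h' : DomLE mu lam) :
    lam = mu := eq_of_sum_take_eq fun t => le_antisymm (h t) (h' t)

/-- The first `t` entries of a decreasing list have the largest sum among all choices of at most `t`
entries. -/
lemma sum_le_sum_take {l : List ℕ} (hl : l.Pairwise (· ≥ ·)) {t : ℕ} {s : Multiset ℕ}
    (hs : s ≤ (l : Multiset ℕ)) (ht : s.card ≤ t) : s.sum ≤ (l.take t).sum := by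
  induction l generalizing t s with
  | nil =>
    rw [Multiset.coe_nil, Multiset.le_zero] at hs
    simp [hs]
  | cons a l ih =>
    rw [List.pairwise_cons] at hl
    by_cases h0 : s = 0
    · simp [h0]
    · have hpos := Multiset.card_pos.2 h0
      obtain ⟨t, rfl⟩ : ∃ u, t = u + 1 := ⟨t - 1, by omega⟩
      rw [List.take_succ_cons, List.sum_cons]
      rw [← Multiset.cons_coe] at hs
      by_cases ha : a ∈ s
      · obtain ⟨s', rfl⟩ := Multiset.exists_cons_of_mem ha
        rw [Multiset.sum_cons]
        exact Nat.add_le_add_left (ih hl.2 ((Multiset.cons_le_cons_iff a).1 hs)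
          (by simpa using ht)) a
      · obtain ⟨b, hb⟩ := Multiset.exists_mem_of_ne_zero h0
        obtain ⟨s', rfl⟩ := Multiset.exists_cons_of_mem hb
        have hsl := (Multiset.le_cons_of_notMem ha).1 hs
        have hbl : b ∈ l := by simpa using Multiset.mem_of_le hsl hb
        rw [Multiset.sum_cons]
        exact Nat.add_le_add (hl.1 b hbl)
          (ih hl.2 ((Multiset.le_cons_self s' b).trans hsl) (by simpa using ht))

lemma getD_moveRows {l : List ℕ} {i j k : ℕ} (hij : i < j) (hj : j < l.length) (x : ℕ) :
    (moveRows l i j k).getD x 0 =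
      if x = j then l.getD j 0 - k else if x = i then l.getD i 0 + k else l.getD x 0 := by
  rw [moveRows]
  by_cases h1 : x = j
  · subst h1
    simp [List.getD, hj]
  · by_cases h2 : x = i
    · subst h2
      simp [List.getD, Ne.symm h1, h1, hij.trans hj]
    · simp [List.getD, Ne.symm h1, Ne.symm h2, h1, h2]

lemma sum_take_le_moveRows {l : List ℕ} {i j k : ℕ} (hij : i < j) (hk : 0 < k)
    (hj : k ≤ l.getD j 0) (t : ℕ) : (l.take t).sum ≤ ((moveRows l i j k).take t).sum := by
  have hjl := lt_length_of_getD_pos (hk.trans_le hj)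
  have h1 : ∀ x, (((moveRows l i j k).getD x 0 : ℕ) : ℤ) =
      l.getD x 0 + (if i = x then (k : ℤ) else 0) - (if j = x then (k : ℤ) else 0) := by
    intro x
    rw [getD_moveRows hij hjl]
    split_ifs <;> subst_vars <;> omega
  rw [sum_take_eq, sum_take_eq]
  zify
  simp only [h1, Finset.sum_add_distrib, Finset.sum_sub_distrib, Finset.sum_ite_eq,
    Finset.mem_range]
  split_ifs <;> omega

/-- Moving squares to an earlier row does not decrease any partial sum, and neither does sorting
afterwards. -/
lemma MovesUp.domLE {n : ℕ} {lam mu : n.Partition} (h : MovesUp lam mu) : DomLE lam mu := by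
  obtain ⟨i, j, k, hij, hk, hj, hmu⟩ := h
  intro t
  refine (sum_take_le_moveRows hij hk hj t).trans ?_
  set m := moveRows (rows lam) i j k
  have hs : ∀ s : Multiset ℕ, (s.filter (· ≠ 0)).sum = s.sum := by
    intro s
    induction s using Multiset.induction_on with
    | empty => simp
    | cons a s ih =>
      by_cases ha : a = 0
      · simpa [ha] using ih
      · simpa [ha] using ih
  have h1 : (((m.take t : List ℕ) : Multiset ℕ).filter (· ≠ 0)) ≤ (rows mu : Multiset ℕ) := by
    rw [rows_coe, hmu]
    exact Multiset.filter_le_filter _ (Multiset.coe_le.2 (List.take_sublist t m).subperm)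
  have h2 := sum_le_sum_take (rows_pairwise mu) h1 (t := t)
    ((Multiset.card_le_card (Multiset.filter_le _ _)).trans (by simp))
  rwa [hs, Multiset.sum_coe] at h2

lemma MovesUp.ne {n : ℕ} {lam mu : n.Partition} (h : MovesUp lam mu) : lam ≠ mu := by
  rintro rfl
  exact lt_irrefl _ h.sq_lt

/-- The sum `∑_i i λ_i`. -/
def rowSum {n : ℕ} (lam : n.Partition) : ℕ :=
  ∑ i ∈ Finset.range (rows lam).length, (i + 1) * (rows lam).getD i 0

lemma sum_mul_add_sum_sum (f : ℕ → ℕ) (M : ℕ) :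
    ∑ x ∈ Finset.range M, (x + 1) * f x + ∑ t ∈ Finset.range (M + 1), ∑ x ∈ Finset.range t, f x =
      (M + 1) * ∑ x ∈ Finset.range M, f x := by
  induction M with
  | zero => simp
  | succ M ih =>
    rw [Finset.sum_range_succ, Finset.sum_range_succ _ (M + 1), Finset.sum_range_succ f M]
    linarith

/-- Summation by parts: up to a constant, `∑ i λ_i` is minus the sum of the partial sums that define
dominance. It therefore strictly decreases along the order. -/
lemma rowSum_eq {n : ℕ} (lam : n.Partition) {M : ℕ} (hM : (rows lam).length ≤ M) :
    rowSum lam + ∑ t ∈ Finset.range (M + 1), ((rows lam).take t).sum = (M + 1) * n := by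
  have h1 := sum_mul_add_sum_sum (fun x => (rows lam).getD x 0) M
  simp only [← sum_take_eq] at h1
  rw [List.take_of_length_le hM, rows_sum] at h1
  rw [← h1, rowSum]
  congr 1
  refine Finset.sum_subset (Finset.range_subset_range.2 hM) fun x _ hx => ?_
  rw [List.getD_eq_default _ _ (by simpa using hx), mul_zero]

lemma DomLT.rowSum_lt {n : ℕ} {mu lam : n.Partition} (h : DomLT mu lam) :
    rowSum lam < rowSum mu := by
  by_contra hcon
  apply h.2
  have e1 := rowSum_eq mu (le_max_left (rows mu).length (rows lam).length)
  have e2 := rowSum_eq lam (le_max_right (rows mu).length (rows lam).length)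
  set M := max (rows mu).length (rows lam).length
  have h1 : ∀ t ∈ Finset.range (M + 1), ((rows mu).take t).sum ≤ ((rows lam).take t).sum :=
    fun t _ => h.1 t
  have h2 := Finset.sum_le_sum h1
  have h3 := (Finset.sum_eq_sum_iff_of_le h1).1 (by omega)
  refine eq_of_sum_take_eq fun t => ?_
  by_cases ht : t < M + 1
  · exact h3 t (Finset.mem_range.2 ht)
  · rw [List.take_of_length_le (by omega), List.take_of_length_le (by omega), rows_sum, rows_sum]

/-- As a polynomial in `α`, `e'_λ` has constant term `-∑ i λ_i`; comparing constant terms suffices.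
-/
lemma ePrime_ne {n : ℕ} {mu lam : n.Partition} (h : rowSum mu ≠ rowSum lam) :
    ePrime mu ≠ ePrime lam := by
  have key : ∀ nu : n.Partition, ∃ a : ℕ, 2 * ePrime nu = algebraMap (Polynomial ℚ) F
      (Polynomial.X * (a : Polynomial ℚ) - Polynomial.C (2 * (rowSum nu : ℚ))) := by
    intro nu
    refine ⟨∑ i ∈ Finset.range (rows nu).length, (rows nu).getD i 0 ^ 2, ?_⟩
    rw [ePrime, α, rowSum]
    simp only [map_sub, map_mul, RatFunc.algebraMap_X, map_natCast, map_ofNat]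
    push_cast
    ring
  intro e
  obtain ⟨a, ha⟩ := key mu
  obtain ⟨b, hb⟩ := key lam
  rw [e, hb] at ha
  have h1 := congrArg (Polynomial.coeff · 0) (RatFunc.algebraMap_injective ℚ ha)
  simp only [Polynomial.coeff_sub, Polynomial.mul_coeff_zero, Polynomial.coeff_X_zero, zero_mul,
    zero_sub, neg_inj, Polynomial.coeff_C_zero] at h1
  apply h
  have h2 : (rowSum lam : ℚ) = rowSum mu := by linarith
  exact_mod_cast h2.symm

/-! ### The Laplace–Beltrami operator and moving up -/

-- Up to zeros, the multisets `{a, b, a'+k', b'-k'}` and `{a', b', a+k, b-k}` agree. Comparing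
-- largest entries identifies `a+k` with `a'+k'`, then `a` with `a'`, then `b` with `b'`.
set_option maxHeartbeats 1000000 in
lemma IsMove.unique {n : ℕ} {lam mu : n.Partition} {i j k i' j' k' : ℕ}
    (h : IsMove lam mu i j k) (h' : IsMove lam mu i' j' k') :
    (rows lam).getD i' 0 = (rows lam).getD i 0 ∧ (rows lam).getD j' 0 = (rows lam).getD j 0 ∧
      k' = k := by
  have c1 := fun x (hx : x ≠ 0) => h.count hx
  have c2 := fun x (hx : x ≠ 0) => h'.count hx
  have m1 := rows_antitone lam h.1
  have m2 := rows_antitone lam h'.1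
  have k1 := h.2.1
  have k2 := h'.2.1
  have l1 := h.2.2.1
  have l2 := h'.2.2.1
  generalize (rows lam).getD i 0 = a at *
  generalize (rows lam).getD j 0 = b at *
  generalize (rows lam).getD i' 0 = a' at *
  generalize (rows lam).getD j' 0 = b' at *
  have key : ∀ x, x ≠ 0 → ((if x = a then 1 else 0) + (if x = b then 1 else 0) +
      ((if x = a' + k' then 1 else 0) + (if x = b' - k' then 1 else 0)) =
      (if x = a' then 1 else 0) + (if x = b' then 1 else 0) +
      ((if x = a + k then 1 else 0) + (if x = b - k then 1 else 0))) := by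
    intro x hx
    have u1 := c1 x hx
    have u2 := c2 x hx
    omega
  clear c1 c2 h h'
  have s1 : a + k = a' + k' := by
    rcases lt_trichotomy (a + k) (a' + k') with hl | hl | hl
    · have u1 := key (a' + k') (by omega)
      split_ifs at u1 <;> omega
    · exact hl
    · have u1 := key (a + k) (by omega)
      split_ifs at u1 <;> omega
  have s2 : a = a' := by
    rcases lt_trichotomy a a' with hl | hl | hl
    · have u1 := key a' (by omega)
      split_ifs at u1 <;> omega
    · exact hl
    · have u1 := key a (by omega)
      split_ifs at u1 <;> omega
  have s3 : b = b' := by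
    rcases lt_trichotomy b b' with hl | hl | hl
    · have u1 := key b' (by omega)
      split_ifs at u1 <;> omega
    · exact hl
    · have u1 := key b (by omega)
      split_ifs at u1 <;> omega
  omega

lemma IsMove.of_getD_eq {n : ℕ} {lam mu : n.Partition} {i j k i' j' : ℕ}
    (h : IsMove lam mu i j k) (hij : i' < j') (hi : (rows lam).getD i' 0 = (rows lam).getD i 0)
    (hj : (rows lam).getD j' 0 = (rows lam).getD j 0) : IsMove lam mu i' j' k := by
  refine ⟨hij, h.2.1, hj ▸ h.2.2.1, ?_⟩
  have h1 := moveRows_add h.1 h.2.1 h.2.2.1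
  have h2 := moveRows_add hij h.2.1 (hj ▸ h.2.2.1 : k ≤ (rows lam).getD j' 0)
  rw [hi, hj, ← h1] at h2
  rw [h.2.2.2, add_right_cancel h2]

lemma exists_isMove {n : ℕ} (lam : n.Partition) {i j k : ℕ} (hij : i < j) (hk : 0 < k)
    (hj : k ≤ (rows lam).getD j 0) : ∃ mu, IsMove lam mu i j k := by
  refine ⟨Nat.Partition.ofSums n (moveRows (rows lam) i j k : Multiset ℕ) ?_, hij, hk, hj, rfl⟩
  have h1 := congrArg Multiset.sum (moveRows_add hij hk hj)
  have h2 := rows_sum lam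
  simp only [Multiset.sum_add, Multiset.sum_coe, Multiset.insert_eq_cons, Multiset.sum_cons,
    Multiset.sum_singleton] at h1
  rw [Multiset.sum_coe]
  omega

lemma IsMove.eq_of {n : ℕ} {lam mu nu : n.Partition} {i j k : ℕ} (h : IsMove lam mu i j k)
    (h' : IsMove lam nu i j k) : mu = nu := by
  apply Nat.Partition.ext
  rw [h.2.2.2, h'.2.2.2]

/-- Counts pairs of rows `i < j` of lengths `a` and `b`. For `a > b` the condition `i < j` is
automatic; for `a = b` it selects half of the ordered pairs of distinct rows, whence the factor `(1
+ δ)⁻¹`. -/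
lemma sum_pairs {n : ℕ} (lam : n.Partition) {a b : ℕ} (hab : b ≤ a) :
    ∑ j ∈ Finset.range (rows lam).length, ∑ i ∈ Finset.range (rows lam).length with i < j,
      (if (rows lam).getD i 0 = a ∧ (rows lam).getD j 0 = b then (1 : F) else 0) =
      (1 + if a = b then 1 else 0)⁻¹ * (mult a lam : F) *
        ((mult b lam : F) - if a = b then 1 else 0) := by
  set l := (rows lam).length
  have hprod : ∑ j ∈ Finset.range l, ∑ i ∈ Finset.range l,
      (if (rows lam).getD i 0 = a ∧ (rows lam).getD j 0 = b then (1 : F) else 0) =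
      mult a lam * mult b lam := by
    rw [mult_eq_sum, mult_eq_sum, Finset.sum_mul_sum, Finset.sum_comm]
    refine Finset.sum_congr rfl fun i _ => Finset.sum_congr rfl fun j _ => ?_
    split_ifs <;> simp_all
  simp only [Finset.sum_filter]
  by_cases h : a = b
  · subst h
    set c : ℕ → ℕ → F := fun j i =>
      if (rows lam).getD i 0 = a ∧ (rows lam).getD j 0 = a then (1 : F) else 0 with hc
    have hsymm : ∀ i j, c i j = c j i := fun i j => by simp only [hc, and_comm]
    have h1 : ∑ j ∈ Finset.range l, ∑ i ∈ Finset.range l, c j i =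
        ∑ j ∈ Finset.range l, ∑ i ∈ Finset.range l, (if i < j then c j i else 0) +
        ∑ j ∈ Finset.range l, ∑ i ∈ Finset.range l, (if i < j then c j i else 0) +
        mult a lam := by
      conv_rhs => enter [1, 2]; rw [Finset.sum_comm]
      rw [mult_eq_sum, ← Finset.sum_add_distrib, ← Finset.sum_add_distrib]
      refine Finset.sum_congr rfl fun j hj => ?_
      have h2 : (if (rows lam).getD j 0 = a then (1 : F) else 0) =
          ∑ i ∈ Finset.range l, if j = i then c j i else 0 := by
        rw [Finset.sum_ite_eq, if_pos hj]
        simp [hc]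
      rw [h2, ← Finset.sum_add_distrib, ← Finset.sum_add_distrib]
      refine Finset.sum_congr rfl fun i _ => ?_
      rw [hsymm i j]
      rcases lt_trichotomy i j with hl | hl | hl
      · rw [if_pos hl, if_neg hl.not_gt, if_neg hl.ne']
        ring
      · subst hl
        rw [if_neg (lt_irrefl i), if_pos rfl]
        ring
      · rw [if_neg hl.not_gt, if_pos hl, if_neg hl.ne]
        ring
    rw [hprod] at h1
    rw [if_pos rfl]
    have h3 : (1 + 1 : F) ≠ 0 := by norm_num
    rw [mul_assoc, eq_inv_mul_iff_mul_eq₀ h3]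
    linear_combination -h1
  · rw [if_neg h, add_zero, inv_one, one_mul, sub_zero, ← hprod]
    refine Finset.sum_congr rfl fun j _ => Finset.sum_congr rfl fun i _ => ?_
    by_cases h1 : (rows lam).getD i 0 = a ∧ (rows lam).getD j 0 = b
    · rw [if_pos h1, if_pos]
      by_contra hcon
      rcases eq_or_lt_of_le (not_lt.1 hcon) with hl | hl
      · subst hl
        exact h (h1.1.symm.trans h1.2)
      · have := rows_antitone lam hl
        omega
    · rw [if_neg h1, ite_self]

-- All moves from `λ` to `μ` have the same row lengths and the same `k`, so the sum is one common
-- coefficient times the number of admissible pairs of rows.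
open Classical in
lemma sum_isMove {n : ℕ} (lam mu : n.Partition) :
    ∑ j ∈ Finset.range (rows lam).length, ∑ i ∈ Finset.range (rows lam).length with i < j,
      ∑ k ∈ Finset.range ((rows lam).getD j 0), (if IsMove lam mu i j (k + 1) then
        (((rows lam).getD i 0 : F) - (rows lam).getD j 0 + 2 * ((k : F) + 1)) else 0) =
      if MovesUp lam mu then r lam mu else 0 := by
  by_cases h : MovesUp lam mu
  · rw [if_pos h]
    obtain ⟨i₀, j₀, k₀, h₀⟩ := h
    rw [r_eq_moveCoeff h₀, moveCoeff, ← sum_pairs lam (rows_antitone lam h₀.1), Finset.sum_mul]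
    refine Finset.sum_congr rfl fun j _ => ?_
    rw [Finset.sum_mul]
    refine Finset.sum_congr rfl fun i hi => ?_
    have hij := (Finset.mem_filter.1 hi).2
    by_cases h1 : (rows lam).getD i 0 = (rows lam).getD i₀ 0 ∧
        (rows lam).getD j 0 = (rows lam).getD j₀ 0
    · rw [if_pos h1, one_mul, Finset.sum_eq_single (k₀ - 1)]
      · have hk := h₀.2.1
        have hk' : k₀ - 1 + 1 = k₀ := by omega
        rw [hk', if_pos (h₀.of_getD_eq hij h1.1 h1.2), h1.1, h1.2, Nat.cast_sub hk, Nat.cast_one,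
          sub_add_cancel]
      · intro k _ hk
        rw [if_neg]
        intro h2
        have := (h₀.unique h2).2.2
        omega
      · intro hk
        have := h₀.2.2.1
        have := h₀.2.1
        rw [Finset.mem_range, h1.2] at hk
        omega
    · rw [if_neg h1, zero_mul]
      refine Finset.sum_eq_zero fun k _ => ?_
      rw [if_neg]
      intro h2
      exact h1 ⟨(h₀.unique h2).1, (h₀.unique h2).2.1⟩
  · rw [if_neg h]
    refine Finset.sum_eq_zero fun j _ => Finset.sum_eq_zero fun i _ => Finset.sum_eq_zero
      fun k _ => if_neg fun h' => h ⟨i, j, k + 1, h'⟩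

open Classical in
/-- The Laplace–Beltrami operator acts on the products of the `g_n` by moving up. -/
theorem lbOp_ghM {n N : ℕ} (h : n ≤ N) (lam : n.Partition) :
    lbOp N (ghM lam.parts) = ePrime lam • ghM lam.parts +
      ∑ mu : n.Partition, (if MovesUp lam mu then r lam mu else 0) • ghM mu.parts := by
  set L := rows lam with hL
  set S := Finset.range L.length with hS
  have hle : ∀ i, L.getD i 0 ≤ N := by
    intro i
    refine le_trans ?_ h
    by_cases hi : i < L.length
    · rw [List.getD_eq_getElem _ _ hi, ← rows_sum lam]
      exact List.le_sum_of_mem (List.getElem_mem hi)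
    · rw [List.getD_eq_default _ _ (not_lt.1 hi)]
      exact Nat.zero_le _
  have hghM : ∀ T : Finset ℕ, ∏ i ∈ T, gh (L.getD i 0) = ghM (T.val.map fun i => L.getD i 0) := by
    intro T
    rw [ghM, Multiset.map_map]
    rfl
  have hprod : ghM lam.parts = ∏ i ∈ S, gh (L.getD i 0) := by
    rw [hghM, map_getD_range, rows_coe]
  have hmove : ∀ j ∈ S, ∀ i ∈ S.filter (· < j), ∀ k ∈ Finset.range (L.getD j 0),
      ((L.getD i 0 : F) - L.getD j 0 + 2 * ((k : F) + 1)) •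
        ((gh (L.getD i 0 + (k + 1)) * gh (L.getD j 0 - (k + 1))) *
          ∏ l ∈ (S.erase i).erase j, gh (L.getD l 0)) =
      ∑ mu : n.Partition, (if IsMove lam mu i j (k + 1) then
        ((L.getD i 0 : F) - L.getD j 0 + 2 * ((k : F) + 1)) else 0) • ghM mu.parts := by
    intro j hj i hi k hk
    obtain ⟨hi, hij⟩ := Finset.mem_filter.1 hi
    have hk' : k + 1 ≤ L.getD j 0 := Finset.mem_range.1 hk
    obtain ⟨mu, hmu⟩ := exists_isMove lam hij (Nat.succ_pos k) hk'
    rw [Finset.sum_eq_single mu, if_pos hmu]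
    · congr 1
      have h1 := moveRows_add hij (Nat.succ_pos k) hk'
      have h2 : (L : Multiset ℕ) = L.getD i 0 ::ₘ L.getD j 0 ::ₘ
          (((S.erase i).erase j).val.map fun i => L.getD i 0) := by
        have hj' : j ∈ S.erase i := Finset.mem_erase.2 ⟨hij.ne', hj⟩
        rw [← map_getD_range L, ← Multiset.map_cons (fun i => L.getD i 0),
          ← Multiset.map_cons (fun i => L.getD i 0), Finset.erase_val, Multiset.cons_erase hj',
          Finset.erase_val, Multiset.cons_erase hi]
      have h3 : (moveRows L i j (k + 1) : Multiset ℕ) = (L.getD i 0 + (k + 1)) ::ₘ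
          (L.getD j 0 - (k + 1)) ::ₘ (((S.erase i).erase j).val.map fun i => L.getD i 0) := by
        refine add_right_cancel (h1.trans ?_)
        rw [h2]
        simp only [Multiset.insert_eq_cons, ← Multiset.singleton_add]
        abel
      rw [hmu.2.2.2, ghM_filter, h3, ghM_cons, ghM_cons, hghM, mul_assoc]
    · intro nu _ hnu
      rw [if_neg fun h' => hnu (h'.eq_of hmu), zero_smul]
    · intro h'
      exact absurd (Finset.mem_univ _) h'
  have hpair : ∀ j ∈ S, ∀ i ∈ S.filter (· < j),
      carre N (gh (L.getD i 0)) (gh (L.getD j 0)) * ∏ l ∈ (S.erase i).erase j, gh (L.getD l 0) =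
      -(L.getD j 0 : F) • ghM lam.parts + ∑ k ∈ Finset.range (L.getD j 0), ∑ mu : n.Partition,
        (if IsMove lam mu i j (k + 1) then
        ((L.getD i 0 : F) - L.getD j 0 + 2 * ((k : F) + 1)) else 0) • ghM mu.parts := by
    intro j hj i hi
    have hi' := Finset.mem_filter.1 hi
    have hj' : j ∈ S.erase i := Finset.mem_erase.2 ⟨hi'.2.ne', hj⟩
    rw [carre_gh (hle i) (hle j), add_mul, smul_mul_assoc, mul_assoc,
      Finset.mul_prod_erase _ (fun l => gh (L.getD l 0)) hj',
      Finset.mul_prod_erase _ (fun l => gh (L.getD l 0)) hi'.1, ← hprod, Finset.sum_mul]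
    congr 1
    refine Finset.sum_congr rfl fun k hk => ?_
    rw [smul_mul_assoc, hmove j hj i hi k hk]
  have hdiag : ∀ i ∈ S, lbOp N (gh (L.getD i 0)) * ∏ l ∈ S.erase i, gh (L.getD l 0) =
      (α / 2 * (L.getD i 0 : F) ^ 2 - L.getD i 0) • ghM lam.parts := by
    intro i hi
    rw [lbOp_gh (hle i), smul_mul_assoc, Finset.mul_prod_erase S (fun l => gh (L.getD l 0)) hi,
      ← hprod]
  conv_lhs => rw [hprod]
  rw [lbOp_prod, Finset.sum_congr rfl hdiag,
    Finset.sum_congr rfl fun j hj => Finset.sum_congr rfl (hpair j hj)]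
  simp only [Finset.sum_add_distrib]
  rw [← add_assoc]
  congr 1
  -- Row `j`, counted from zero, contributes `-λ_j` once for each of the `j` rows above it and once
  -- more from its own eigenvalue, which gives the `-(j + 1) λ_j` of `e'_λ`.
  · have hcard : ∀ j ∈ S, ∑ i ∈ S with i < j, -(L.getD j 0 : F) • ghM lam.parts =
        (-(j : F) * L.getD j 0) • ghM lam.parts := by
      intro j hj
      have h1 : S.filter (· < j) = Finset.range j := by
        ext i
        have := Finset.mem_range.1 hj
        simp only [hS, Finset.mem_filter, Finset.mem_range]
        omega
      rw [h1, Finset.sum_const, Finset.card_range, ← Nat.cast_smul_eq_nsmul F, smul_smul]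
      congr 1
      ring
    rw [Finset.sum_congr rfl hcard, ← Finset.sum_add_distrib, ePrime, Finset.mul_sum,
      ← Finset.sum_sub_distrib, Finset.sum_smul]
    refine Finset.sum_congr rfl fun j _ => ?_
    rw [← add_smul]
    congr 1
    ring
  · simp only [← sum_isMove, Finset.sum_smul]
    symm
    rw [Finset.sum_comm]
    refine Finset.sum_congr rfl fun j _ => ?_
    rw [Finset.sum_comm]
    refine Finset.sum_congr rfl fun i _ => ?_
    rw [Finset.sum_comm]

/-! ### Triangularity with respect to the dominance order -/

lemma domLT_wellFounded (n : ℕ) : WellFounded (DomLT : n.Partition → n.Partition → Prop) := by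
  have : IsTrans n.Partition DomLT := ⟨fun a b c h h' => ⟨h.1.trans h'.1, by
    rintro rfl
    exact h.2 (h.1.antisymm h'.1)⟩⟩
  have : Std.Irrefl (DomLT : n.Partition → n.Partition → Prop) := ⟨fun a h => h.2 rfl⟩
  exact Finite.wellFounded_of_trans_of_irrefl _

lemma domLT_swap_wellFounded (n : ℕ) :
    WellFounded (fun mu lam : n.Partition => DomLT lam mu) := by
  have : IsTrans n.Partition fun mu lam => DomLT lam mu := ⟨fun a b c h h' => ⟨h'.1.trans h.1, by
    rintro rfl
    exact h.2 (h.1.antisymm h'.1)⟩⟩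
  have : Std.Irrefl (fun mu lam : n.Partition => DomLT lam mu) := ⟨fun a h => h.2 rfl⟩
  exact Finite.wellFounded_of_trans_of_irrefl _

/-- Forward substitution for a unitriangular system of linear equations. -/
lemma eq_zero_of_triangular {ι : Type*} [Fintype ι] {lt : ι → ι → Prop} (wf : WellFounded lt)
    {c : ι → ι → F} (c_diag : ∀ i, c i i = 1) (c_lt : ∀ i j, j ≠ i → c j i ≠ 0 → lt j i)
    (S : ι → Prop) (hS : ∀ i j, S i → lt j i → S j) {X : ι → F}
    (hX : ∀ i, S i → ∑ j, X j * c j i = 0) (i : ι) (hi : S i) : X i = 0 := by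
  induction i using wf.induction with
  | _ i ih =>
    have h := hX i hi
    rw [Finset.sum_eq_single i, c_diag, mul_one] at h
    · exact h
    · intro j _ hji
      by_cases hc : c j i = 0
      · rw [hc, mul_zero]
      · have hlt := c_lt i j hji hc
        rw [ih j hlt (hS i j hi hlt), zero_mul]
    · intro h'
      exact absurd (Finset.mem_univ _) h'

/-! ### Coefficients of symmetric functions -/

lemma exists_finsupp (s : Multiset ℕ) (hs : ∀ x ∈ s, x ≠ 0) :
    ∃ d : ℕ →₀ ℕ, d.support.val.map d = s := by
  classical
  refine ⟨s.toList.toFinsupp, ?_⟩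
  have h1 : s.toList.toFinsupp.support = Finset.range s.toList.length := by
    rw [List.toFinsupp_support, Finset.filter_true_of_mem]
    intro i hi
    rw [List.getD_eq_getElem _ _ (Finset.mem_range.1 hi)]
    exact hs _ (Multiset.mem_toList.1 (List.getElem_mem _))
  rw [h1]
  conv_rhs => rw [← Multiset.coe_toList s, ← map_getD_range]
  rfl

lemma coeff_monomialSym {n : ℕ} (mu : n.Partition) (d : ℕ →₀ ℕ) [Decidable
    (d.support.val.map d = mu.parts)] :
    MvPowerSeries.coeff d (monomialSym mu) = if d.support.val.map d = mu.parts then 1 else 0 := by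
  rw [MvPowerSeries.coeff_apply, monomialSym]
  congr

lemma jackInner_ghM_parts {n : ℕ} {h : SymF} {a : n.Partition → F}
    (H : realize h = ∑ mu, a mu • monomialSym mu) (nu : n.Partition) :
    jackInner (ghM nu.parts) h = a nu := by
  classical
  obtain ⟨d, hd⟩ := exists_finsupp nu.parts fun x hx => (nu.parts_pos hx).ne'
  rw [← hd, ← coeff_realize, H, map_sum, Finset.sum_eq_single nu]
  · rw [map_smul, coeff_monomialSym, if_pos hd, smul_eq_mul, mul_one]
  · intro mu _ hmu
    rw [map_smul, coeff_monomialSym, if_neg, smul_zero]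
    intro h'
    exact hmu (Nat.Partition.ext (h'.symm.trans hd))
  · intro h'
    exact absurd (Finset.mem_univ _) h'

/-- The symmetric functions orthogonal to all products of the `g_k` of degrees other than `n`. -/
def degreePart (n : ℕ) : Submodule F SymF where
  carrier := {h | ∀ s : Multiset ℕ, s.sum ≠ n → jackInner (ghM s) h = 0}
  add_mem' hf hh s hs := by rw [map_add, hf s hs, hh s hs, add_zero]
  zero_mem' s _ := map_zero _
  smul_mem' a h hh s hs := by rw [map_smul, hh s hs, smul_zero]

lemma ghM_mem_degreePart (s : Multiset ℕ) : ghM s ∈ degreePart s.sum :=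
  fun _ ht => jackInner_ghM_ghM ht

lemma ghM_parts_mem_degreePart {n : ℕ} (mu : n.Partition) : ghM mu.parts ∈ degreePart n := by
  have := ghM_mem_degreePart mu.parts
  rwa [mu.parts_sum] at this

lemma mem_degreePart_of_realize {n : ℕ} {h : SymF} {a : n.Partition → F}
    (H : realize h = ∑ mu, a mu • monomialSym mu) : h ∈ degreePart n := by
  classical
  intro s hs
  have hsum : (s.filter (· ≠ 0)).sum = s.sum := by
    have h0 : (s.filter fun x => ¬ x ≠ 0).sum = 0 := by
      refine Multiset.sum_eq_zero fun x hx => ?_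
      simpa using (Multiset.mem_filter.1 hx).2
    conv_rhs => rw [← Multiset.filter_add_not (· ≠ 0) s]
    rw [Multiset.sum_add, h0, add_zero]
  obtain ⟨d, hd⟩ := exists_finsupp (s.filter (· ≠ 0)) fun x hx => (Multiset.mem_filter.1 hx).2
  rw [← ghM_filter, ← hd, ← coeff_realize, H, map_sum]
  refine Finset.sum_eq_zero fun mu _ => ?_
  rw [map_smul, coeff_monomialSym, if_neg, smul_zero]
  intro h'
  apply hs
  rw [← hsum, ← hd, h', mu.parts_sum]

lemma eq_zero_of_mem_degreePart {n : ℕ} {h : SymF} (hh : h ∈ degreePart n)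
    (H : ∀ mu : n.Partition, jackInner (ghM mu.parts) h = 0) : h = 0 := by
  refine eq_zero_of_jackInner_ghM h fun s => ?_
  by_cases hs : s.sum = n
  · rw [← ghM_filter]
    exact H (Nat.Partition.ofSums n s hs)
  · exact hh s hs

/-! ### Jack functions as eigenfunctions -/

section Jack

variable {P : ∀ n : ℕ, n.Partition → SymF}

/-- The coefficient of `m_μ` in `P_λ`. -/
def jackCoeff (P : ∀ n : ℕ, n.Partition → SymF) {n : ℕ} (lam mu : n.Partition) : F :=
  jackInner (ghM mu.parts) (P n lam)

lemma jackCoeff_self (hP : IsJackP P) {n : ℕ} (lam : n.Partition) : jackCoeff P lam lam = 1 := by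
  obtain ⟨c, h1, -, h3⟩ := hP.triangular n lam
  rw [jackCoeff, jackInner_ghM_parts h3, h1]

lemma domLE_of_jackCoeff_ne_zero (hP : IsJackP P) {n : ℕ} {lam mu : n.Partition}
    (h : jackCoeff P lam mu ≠ 0) : DomLE mu lam := by
  obtain ⟨c, -, h2, h3⟩ := hP.triangular n lam
  by_contra hcon
  exact h (by rw [jackCoeff, jackInner_ghM_parts h3, h2 mu hcon])

lemma jackP_mem_degreePart (hP : IsJackP P) {n : ℕ} (lam : n.Partition) :
    P n lam ∈ degreePart n := by
  obtain ⟨c, -, -, h3⟩ := hP.triangular n lam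
  exact mem_degreePart_of_realize h3

lemma eq_zero_of_sum_mul_jackCoeff (hP : IsJackP P) {n : ℕ} (S : n.Partition → Prop)
    (hS : ∀ mu nu, S mu → DomLT mu nu → S nu) {X : n.Partition → F}
    (hX : ∀ mu, S mu → ∑ lam, X lam * jackCoeff P lam mu = 0) (mu : n.Partition) (hmu : S mu) :
    X mu = 0 :=
  eq_zero_of_triangular (domLT_swap_wellFounded n) (c := fun lam mu => jackCoeff P lam mu)
    (jackCoeff_self hP)
    (fun _ _ hne hc => ⟨domLE_of_jackCoeff_ne_zero hP hc, hne.symm⟩) S hS hX mu hmu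

lemma eq_zero_of_sum_mul_jackCoeff_right (hP : IsJackP P) {n : ℕ} (S : n.Partition → Prop)
    (hS : ∀ lam nu, S lam → DomLT nu lam → S nu) {X : n.Partition → F}
    (hX : ∀ lam, S lam → ∑ mu, X mu * jackCoeff P lam mu = 0) (lam : n.Partition) (hlam : S lam) :
    X lam = 0 :=
  eq_zero_of_triangular (domLT_wellFounded n) (c := fun mu lam => jackCoeff P lam mu)
    (jackCoeff_self hP)
    (fun _ _ hne hc => ⟨domLE_of_jackCoeff_ne_zero hP hc, hne⟩) S hS hX lam hlam

/-- The coefficient matrix of the `P_λ` is square and unitriangular, so every list of scalar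
products with the `g_μ` is attained; these products determine an element of degree `n`. -/
lemma exists_eq_sum_jackP (hP : IsJackP P) {n : ℕ} {h : SymF} (hh : h ∈ degreePart n) :
    ∃ a : n.Partition → F, h = ∑ lam, a lam • P n lam := by
  let T : (n.Partition → F) →ₗ[F] (n.Partition → F) :=
    { toFun := fun a mu => ∑ lam, a lam * jackCoeff P lam mu
      map_add' := fun a b => by
        ext mu
        simp only [Pi.add_apply, add_mul, Finset.sum_add_distrib]
      map_smul' := fun x a => by
        ext mu
        simp only [Pi.smul_apply, smul_eq_mul, Finset.mul_sum, mul_assoc, RingHom.id_apply] }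
  have hinj : Function.Injective T := by
    rw [injective_iff_map_eq_zero]
    intro a ha
    ext mu
    exact eq_zero_of_sum_mul_jackCoeff hP (fun _ => True) (fun _ _ _ _ => trivial)
      (fun mu _ => congrFun ha mu) mu trivial
  obtain ⟨a, ha⟩ := LinearMap.injective_iff_surjective.1 hinj
    (fun mu => jackInner (ghM mu.parts) h)
  refine ⟨a, sub_eq_zero.1 (eq_zero_of_mem_degreePart (n := n) ?_ fun mu => ?_)⟩
  · exact Submodule.sub_mem _ hh (Submodule.sum_mem _ fun lam _ =>
      Submodule.smul_mem _ _ (jackP_mem_degreePart hP lam))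
  · have := congrFun ha mu
    rw [map_sub, ← this, map_sum]
    simp only [map_smul, smul_eq_mul]
    exact sub_self _

lemma jackInner_jackP_ne (hP : IsJackP P) {n : ℕ} {lam mu : n.Partition} (h : lam ≠ mu) :
    jackInner (P n lam) (P n mu) = 0 :=
  hP.orthogonal n n lam mu fun e => h (Nat.Partition.ext e)

lemma jackInner_sum_jackP (hP : IsJackP P) {n : ℕ} (a : n.Partition → F) (mu : n.Partition) :
    jackInner (∑ lam, a lam • P n lam) (P n mu) = a mu * jackInner (P n mu) (P n mu) := by
  rw [map_sum, LinearMap.sum_apply, Finset.sum_eq_single mu]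
  · rw [map_smul, LinearMap.smul_apply, smul_eq_mul]
  · intro lam _ hlam
    rw [map_smul, LinearMap.smul_apply, jackInner_jackP_ne hP hlam, smul_zero]
  · intro h
    exact absurd (Finset.mem_univ _) h

/-- Expand `g_λ` in the `P_μ`. Pairing with `P_λ` gives `1` by duality and a multiple of the norm by
orthogonality. -/
lemma jackInner_jackP_self_ne_zero (hP : IsJackP P) {n : ℕ} (lam : n.Partition) :
    jackInner (P n lam) (P n lam) ≠ 0 := by
  intro h
  obtain ⟨a, ha⟩ := exists_eq_sum_jackP hP (ghM_parts_mem_degreePart lam)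
  have h1 := jackCoeff_self hP lam
  rw [jackCoeff, ha, jackInner_sum_jackP hP, h, mul_zero] at h1
  exact zero_ne_one h1

lemma domLE_oneRow {n : ℕ} (hn : n ≠ 0) (mu : n.Partition) : DomLE mu (oneRow n) := by
  have h1 : rows (oneRow n) = [n] := by
    rw [rows, Nat.Partition.indiscrete_parts hn, Multiset.sort_singleton]
  intro i
  cases i with
  | zero => simp
  | succ i =>
    rw [h1, List.take_succ_cons, List.take_nil, List.sum_singleton]
    conv_rhs => rw [← rows_sum mu]
    exact (List.take_sublist _ _).sum_le_sum fun _ _ => Nat.zero_le _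

/-- The coefficient of `P_μ` in `g_n`, times the norm of `P_μ`, is the coefficient of `m_{(n)}` in
`P_μ`. As `(n)` is maximal, only `μ = (n)` survives. -/
lemma jackQ_oneRow (hP : IsJackP P) {n : ℕ} (hn : n ≠ 0) : jackQ P n (oneRow n) = gh n := by
  have hg : ghM (oneRow n).parts = gh n := by
    rw [Nat.Partition.indiscrete_parts hn, ghM, Multiset.map_singleton, Multiset.prod_singleton]
  obtain ⟨a, ha⟩ := exists_eq_sum_jackP hP (ghM_parts_mem_degreePart (oneRow n))
  have h1 : ∀ mu, a mu * jackInner (P n mu) (P n mu) = jackCoeff P mu (oneRow n) := by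
    intro mu
    rw [jackCoeff, ha, jackInner_sum_jackP hP]
  rw [← hg, ha, Finset.sum_eq_single (oneRow n), jackQ]
  · congr 1
    rw [← eq_inv_of_mul_eq_one_left ((h1 _).trans (jackCoeff_self hP _))]
  · intro mu _ hmu
    have h2 : jackCoeff P mu (oneRow n) = 0 := by
      by_contra h
      exact hmu ((domLE_oneRow hn mu).antisymm (domLE_of_jackCoeff_ne_zero hP h))
    have h3 := h1 mu
    rw [h2] at h3
    rw [(mul_eq_zero.1 h3).resolve_right (jackInner_jackP_self_ne_zero hP mu), zero_smul]
  · intro h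
    exact absurd (Finset.mem_univ _) h

lemma genHom_eq (hP : IsJackP P) {n : ℕ} (lam : n.Partition) : genHom P lam = ghM lam.parts := by
  rw [genHom, ghM]
  congr 1
  exact Multiset.map_congr rfl fun k hk => jackQ_oneRow hP (lam.parts_pos hk).ne'

lemma jackInner_jackQ (hP : IsJackP P) {n : ℕ} (lam mu : n.Partition) :
    jackInner (jackQ P n lam) (P n mu) = if lam = mu then 1 else 0 := by
  rw [jackQ, map_smul, LinearMap.smul_apply, smul_eq_mul]
  by_cases h : lam = mu
  · subst h
    rw [if_pos rfl, inv_mul_cancel₀ (jackInner_jackP_self_ne_zero hP lam)]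
  · rw [if_neg h, jackInner_jackP_ne hP h, mul_zero]

open Classical in
/-- `r_{λμ}` if `μ` is obtained from `λ` by moving up, and `0` otherwise. -/
def moveEntry {n : ℕ} (lam mu : n.Partition) : F := if MovesUp lam mu then r lam mu else 0

lemma domLT_of_moveEntry_ne_zero {n : ℕ} {lam mu : n.Partition} (h : moveEntry lam mu ≠ 0) :
    DomLT lam mu := by
  by_cases h' : MovesUp lam mu
  · exact ⟨h'.domLE, h'.ne⟩
  · rw [moveEntry, if_neg h'] at h
    exact absurd rfl h

lemma lbOp_ghM_parts {n : ℕ} (lam : n.Partition) : lbOp n (ghM lam.parts) =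
    ePrime lam • ghM lam.parts + ∑ mu : n.Partition, moveEntry lam mu • ghM mu.parts :=
  lbOp_ghM le_rfl lam

lemma jackInner_ghM_lbOp {n : ℕ} (mu : n.Partition) (h : SymF) :
    jackInner (ghM mu.parts) (lbOp n h) = ePrime mu * jackInner (ghM mu.parts) h +
      ∑ nu : n.Partition, moveEntry mu nu * jackInner (ghM nu.parts) h := by
  rw [← jackInner_lbOp, lbOp_ghM_parts, map_add, LinearMap.add_apply, map_smul,
    LinearMap.smul_apply, smul_eq_mul, map_sum, LinearMap.sum_apply]
  simp only [map_smul, LinearMap.smul_apply, smul_eq_mul]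

variable {C : ∀ n : ℕ, n.Partition → n.Partition → F}

lemma jackQ_eq (hP : IsJackP P)
    (hC : ∀ (n : ℕ) (mu : n.Partition), jackQ P n mu = ∑ lam, C n mu lam • genHom P lam)
    {n : ℕ} (mu : n.Partition) : jackQ P n mu = ∑ lam, C n mu lam • ghM lam.parts := by
  rw [hC]
  exact Finset.sum_congr rfl fun lam _ => by rw [genHom_eq hP]

lemma jackP_eq_smul_jackQ (hP : IsJackP P) {n : ℕ} (lam : n.Partition) :
    P n lam = jackInner (P n lam) (P n lam) • jackQ P n lam := by
  rw [jackQ, smul_inv_smul₀ (jackInner_jackP_self_ne_zero hP lam)]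

/-- The expansion of `Q_λ` in the `g_μ` is used to keep the image in degree `n`, since the action on
each `g_μ` is known. -/
lemma lbOp_jackP_mem (hP : IsJackP P)
    (hC : ∀ (n : ℕ) (mu : n.Partition), jackQ P n mu = ∑ lam, C n mu lam • genHom P lam)
    {n : ℕ} (lam : n.Partition) : lbOp n (P n lam) ∈ degreePart n := by
  rw [jackP_eq_smul_jackQ hP, jackQ_eq hP hC, map_smul, map_sum]
  refine Submodule.smul_mem _ _ (Submodule.sum_mem _ fun mu _ => ?_)
  rw [map_smul, lbOp_ghM_parts]
  exact Submodule.smul_mem _ _ (Submodule.add_mem _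
    (Submodule.smul_mem _ _ (ghM_parts_mem_degreePart mu)) (Submodule.sum_mem _ fun nu _ =>
      Submodule.smul_mem _ _ (ghM_parts_mem_degreePart nu)))

/-- The Jack functions are eigenfunctions of the Laplace–Beltrami operator. -/
theorem lbOp_jackP (hP : IsJackP P)
    (hC : ∀ (n : ℕ) (mu : n.Partition), jackQ P n mu = ∑ lam, C n mu lam • genHom P lam)
    {n : ℕ} (lam : n.Partition) : lbOp n (P n lam) = ePrime lam • P n lam := by
  choose a ha using fun lam : n.Partition => exists_eq_sum_jackP hP (lbOp_jackP_mem hP hC lam)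
  have hcoeff : ∀ lam mu : n.Partition, ∑ ka, a lam ka * jackCoeff P ka mu =
      ePrime mu * jackCoeff P lam mu + ∑ nu, moveEntry mu nu * jackCoeff P lam nu := by
    intro lam mu
    have := jackInner_ghM_lbOp mu (P n lam)
    rw [ha, map_sum] at this
    simp only [map_smul, smul_eq_mul] at this
    exact this
  have hmove : ∀ lam mu : n.Partition, ¬ DomLT mu lam →
      ∑ nu, moveEntry mu nu * jackCoeff P lam nu = 0 := by
    intro lam mu h
    refine Finset.sum_eq_zero fun nu _ => ?_
    by_contra hne
    have h1 := domLT_of_moveEntry_ne_zero (left_ne_zero_of_mul hne)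
    have h2 := domLE_of_jackCoeff_ne_zero hP (right_ne_zero_of_mul hne)
    refine h ⟨h1.1.trans h2, ?_⟩
    rintro rfl
    exact h1.2 (h1.1.antisymm h2)
  -- Scalar products of `D P_λ` with `g_μ` vanish unless `μ ≤ λ`; unitriangularity transfers this to
  -- the coefficients in the basis `P_κ`.
  have hle : ∀ lam ka : n.Partition, a lam ka ≠ 0 → DomLE ka lam := by
    intro lam ka hne
    by_contra hcon
    refine hne (eq_zero_of_sum_mul_jackCoeff hP (fun mu => ¬ DomLE mu lam)
      (fun mu nu h h' h'' => h (h'.1.trans h'')) (fun mu hmu => ?_) ka hcon)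
    rw [hcoeff, hmove lam mu fun h => hmu h.1, add_zero]
    by_contra h
    exact hmu (domLE_of_jackCoeff_ne_zero hP (right_ne_zero_of_mul h))
  have hsymm : ∀ lam ka : n.Partition, a lam ka * jackInner (P n ka) (P n ka) =
      a ka lam * jackInner (P n lam) (P n lam) := by
    intro lam ka
    rw [← jackInner_sum_jackP hP, ← ha, ← jackInner_sum_jackP hP, ← ha, jackInner_lbOp,
      jackInner_symm]
  -- By self-adjointness a nonzero entry at `(λ, κ)` forces one at `(κ, λ)`, hence both `κ ≤ λ` and
  -- `λ ≤ κ`.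
  have hzero : ∀ ka, ka ≠ lam → a lam ka = 0 := by
    intro ka hka
    by_contra hne
    refine hka ((hle _ _ hne).antisymm (hle _ _ fun h0 => ?_))
    have := hsymm lam ka
    rw [h0, zero_mul] at this
    exact hne ((mul_eq_zero.1 this).resolve_right (jackInner_jackP_self_ne_zero hP ka))
  -- The eigenvalue is read off from the coefficient of `m_λ`, to which no upward move contributes.
  have hself := hcoeff lam lam
  rw [hmove lam lam fun h => h.2 rfl, add_zero, jackCoeff_self hP, mul_one,
    Finset.sum_eq_single lam (fun ka _ hka => by rw [hzero ka hka, zero_mul])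
      (fun h => absurd (Finset.mem_univ _) h), jackCoeff_self hP, mul_one] at hself
  rw [ha, ← hself]
  exact Finset.sum_eq_single lam (fun ka _ hka => by rw [hzero ka hka, zero_smul])
    (fun h => absurd (Finset.mem_univ _) h)

/-! ### Triangularity and recursions of the coefficients `C` and `v` -/

lemma sum_mul_jackCoeff (hP : IsJackP P)
    (hC : ∀ (n : ℕ) (mu : n.Partition), jackQ P n mu = ∑ lam, C n mu lam • genHom P lam)
    {n : ℕ} (mu ka : n.Partition) :
    ∑ lam, C n mu lam * jackCoeff P ka lam = if mu = ka then 1 else 0 := by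
  rw [← jackInner_jackQ hP, jackQ_eq hP hC, map_sum, LinearMap.sum_apply]
  simp only [map_smul, LinearMap.smul_apply, smul_eq_mul]
  rfl

/-- By `sum_mul_jackCoeff` the matrix `C` is inverse to the transpose of the unitriangular matrix of
the `P_κ`, so it is triangular in the opposite direction. -/
lemma genHom_coeff_eq_zero (hP : IsJackP P)
    (hC : ∀ (n : ℕ) (mu : n.Partition), jackQ P n mu = ∑ lam, C n mu lam • genHom P lam)
    {n : ℕ} {mu lam : n.Partition} (h : ¬ DomLE mu lam) : C n mu lam = 0 := by
  refine eq_zero_of_sum_mul_jackCoeff_right hP (fun lam => ¬ DomLE mu lam)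
    (fun lam nu h h' h'' => h (h''.trans h'.1)) (fun ka hka => ?_) lam h
  rw [sum_mul_jackCoeff hP hC, if_neg]
  rintro rfl
  exact hka (DomLE.refl _)

lemma genHom_coeff_self (hP : IsJackP P)
    (hC : ∀ (n : ℕ) (mu : n.Partition), jackQ P n mu = ∑ lam, C n mu lam • genHom P lam)
    {n : ℕ} (mu : n.Partition) : C n mu mu = 1 := by
  have h := sum_mul_jackCoeff hP hC mu mu
  rw [if_pos rfl, Finset.sum_eq_single mu, jackCoeff_self hP, mul_one] at h
  · exact h
  · intro lam _ hne
    by_contra h0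
    refine hne (DomLE.antisymm (domLE_of_jackCoeff_ne_zero hP (right_ne_zero_of_mul h0)) ?_)
    by_contra hcon
    exact left_ne_zero_of_mul h0 (genHom_coeff_eq_zero hP hC hcon)
  · intro h'
    exact absurd (Finset.mem_univ _) h'

/-- Compare the coefficients of `g_ν` in `D Q_μ = e'_μ Q_μ`. The comparison is legitimate because
pairing with all `P_κ` shows the `g_ν` to be linearly independent. -/
lemma genHom_coeff_recursion (hP : IsJackP P)
    (hC : ∀ (n : ℕ) (mu : n.Partition), jackQ P n mu = ∑ lam, C n mu lam • genHom P lam)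
    {n : ℕ} (mu nu : n.Partition) : C n mu nu * (ePrime mu - ePrime nu) =
      ∑ ka, C n mu ka * moveEntry ka nu := by
  have h1 : ePrime mu • jackQ P n mu = ∑ lam, (C n mu lam * ePrime lam) • ghM lam.parts +
      ∑ lam, (∑ ka, C n mu ka * moveEntry ka lam) • ghM lam.parts := by
    have h2 : lbOp n (jackQ P n mu) = ePrime mu • jackQ P n mu := by
      rw [jackQ, map_smul, lbOp_jackP hP hC, smul_comm]
    rw [← h2, jackQ_eq hP hC, map_sum]
    simp only [map_smul, lbOp_ghM_parts, smul_add, Finset.sum_add_distrib, Finset.smul_sum,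
      smul_smul, Finset.sum_smul]
    congr 1
    exact Finset.sum_comm
  have h2 : ∑ lam, (C n mu lam * (ePrime mu - ePrime lam) - ∑ ka, C n mu ka * moveEntry ka lam) •
      ghM lam.parts = 0 := by
    simp only [sub_smul, mul_sub, Finset.sum_sub_distrib]
    rw [sub_sub, ← h1, jackQ_eq hP hC, Finset.smul_sum, sub_eq_zero]
    exact Finset.sum_congr rfl fun lam _ => by rw [smul_smul, mul_comm]
  refine sub_eq_zero.1 (eq_zero_of_sum_mul_jackCoeff_right hP (fun _ => True)
    (fun _ _ _ _ => trivial) (X := fun lam => C n mu lam * (ePrime mu - ePrime lam) -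
      ∑ ka, C n mu ka * moveEntry ka lam) (fun ka _ => ?_) nu trivial)
  have h3 := congrArg (fun f => jackInner f (P n ka)) h2
  simp only [map_sum, LinearMap.sum_apply, map_smul, LinearMap.smul_apply, smul_eq_mul, map_zero,
    LinearMap.zero_apply] at h3
  exact h3

variable {J : ∀ n : ℕ, n.Partition → SymF} {v : ∀ n : ℕ, n.Partition → n.Partition → F}

lemma jackJ_coeff_eq (hJ : IsJackJ P J v) {n : ℕ} (lam mu : n.Partition) :
    v n lam mu = jackInner (ghM mu.parts) (J n lam) :=
  (jackInner_ghM_parts (hJ.expansion n lam) mu).symm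

lemma jackJ_coeff_eq_zero (hP : IsJackP P) (hJ : IsJackJ P J v) {n : ℕ} {lam mu : n.Partition}
    (h : ¬ DomLE mu lam) : v n lam mu = 0 := by
  obtain ⟨c, hc⟩ := hJ.multiple n lam
  rw [jackJ_coeff_eq hJ, hc, map_smul, ← jackCoeff]
  by_contra h0
  exact h (domLE_of_jackCoeff_ne_zero hP (right_ne_zero_of_mul h0))

lemma jackJ_coeff_recursion (hP : IsJackP P)
    (hC : ∀ (n : ℕ) (mu : n.Partition), jackQ P n mu = ∑ lam, C n mu lam • genHom P lam)
    (hJ : IsJackJ P J v) {n : ℕ} (lam mu : n.Partition) :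
    v n lam mu * (ePrime lam - ePrime mu) = ∑ nu, moveEntry mu nu * v n lam nu := by
  obtain ⟨c, hc⟩ := hJ.multiple n lam
  have h1 : lbOp n (J n lam) = ePrime lam • J n lam := by
    rw [hc, map_smul, lbOp_jackP hP hC, smul_comm]
  have h2 := jackInner_ghM_lbOp mu (J n lam)
  rw [h1, map_smul, smul_eq_mul] at h2
  simp only [jackJ_coeff_eq hJ]
  linear_combination h2

end Jack

/-! ### Sums over moving up filtrations -/

lemma mem_filtrations {n : ℕ} {mu lam : n.Partition} {δ : List n.Partition} :
    δ ∈ filtrations mu lam ↔ δ.head? = some mu ∧ δ.getLast? = some lam ∧ δ.IsChain MovesUp := by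
  rw [filtrations, Set.Finite.mem_toFinset]
  rfl

lemma domLE_of_mem_filtrations {n : ℕ} {mu lam : n.Partition} {δ : List n.Partition}
    (h : δ ∈ filtrations mu lam) : DomLE mu lam := by
  obtain ⟨h1, h2, h3⟩ := mem_filtrations.1 h
  clear h
  induction δ generalizing mu with
  | nil => simp at h1
  | cons a t ih =>
    obtain rfl : a = mu := by simpa using h1
    cases t with
    | nil =>
      obtain rfl : a = lam := by simpa using h2
      exact DomLE.refl _
    | cons b t =>
      rw [List.isChain_cons_cons] at h3
      exact h3.1.domLE.trans (ih rfl (by simpa using h2) h3.2)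

lemma filtrations_eq_empty {n : ℕ} {mu lam : n.Partition} (h : ¬ DomLE mu lam) :
    filtrations mu lam = ∅ :=
  Finset.eq_empty_of_forall_notMem fun _ hδ => h (domLE_of_mem_filtrations hδ)

lemma filtrations_self {n : ℕ} (lam : n.Partition) : filtrations lam lam = {[lam]} := by
  ext δ
  rw [Finset.mem_singleton]
  constructor
  · intro h
    obtain ⟨h1, h2, h3⟩ := mem_filtrations.1 h
    cases δ with
    | nil => simp at h1
    | cons a t =>
      obtain rfl : a = lam := by simpa using h1
      cases t with
      | nil => rfl
      | cons b t =>
        rw [List.isChain_cons_cons] at h3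
        have h4 : (b :: t) ∈ filtrations b a := mem_filtrations.2 ⟨rfl, by simpa using h2, h3.2⟩
        exact absurd (h3.1.domLE.antisymm (domLE_of_mem_filtrations h4)) h3.1.ne
  · rintro rfl
    exact mem_filtrations.2 ⟨rfl, rfl, List.isChain_singleton _⟩

lemma sum_fUp_self {n : ℕ} (lam : n.Partition) : ∑ δ ∈ filtrations lam lam, fUp lam δ = 1 := by
  simp [filtrations_self, fUp]

lemma sum_fDown_self {n : ℕ} (mu : n.Partition) : ∑ δ ∈ filtrations mu mu, fDown mu δ = 1 := by
  simp [filtrations_self, fDown]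

open Classical in
lemma filtrations_eq_biUnion_cons {n : ℕ} {mu lam : n.Partition} (hne : mu ≠ lam) :
    filtrations mu lam = (Finset.univ.filter fun nu => MovesUp mu nu).biUnion
      fun nu => (filtrations nu lam).image (List.cons mu) := by
  ext δ
  simp only [Finset.mem_biUnion, Finset.mem_filter, Finset.mem_univ, true_and, Finset.mem_image]
  constructor
  · intro h
    obtain ⟨h1, h2, h3⟩ := mem_filtrations.1 h
    cases δ with
    | nil => simp at h1
    | cons a t =>
      obtain rfl : a = mu := by simpa using h1
      cases t with
      | nil => exact absurd (by simpa using h2) hne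
      | cons b t =>
        rw [List.isChain_cons_cons] at h3
        exact ⟨b, h3.1, b :: t, mem_filtrations.2 ⟨rfl, by simpa using h2, h3.2⟩, rfl⟩
  · rintro ⟨nu, hnu, t, ht, rfl⟩
    obtain ⟨h1, h2, h3⟩ := mem_filtrations.1 ht
    cases t with
    | nil => simp at h1
    | cons b t =>
      obtain rfl : b = nu := by simpa using h1
      exact mem_filtrations.2 ⟨rfl, by simpa using h2, List.isChain_cons_cons.2 ⟨hnu, h3⟩⟩

/-- The denominators of `f^λ` involve the endpoint `λ` and the starting point of each step, so the
first step can be split off leaving `f^λ` of the rest. -/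
lemma sum_fUp_recursion {n : ℕ} {mu lam : n.Partition} (hne : mu ≠ lam) :
    ∑ δ ∈ filtrations mu lam, fUp lam δ = (∑ nu : n.Partition, moveEntry mu nu *
      ∑ δ ∈ filtrations nu lam, fUp lam δ) / (ePrime lam - ePrime mu) := by
  classical
  rw [filtrations_eq_biUnion_cons hne, Finset.sum_biUnion, Finset.sum_filter, Finset.sum_div]
  · refine Finset.sum_congr rfl fun nu _ => ?_
    by_cases h : MovesUp mu nu
    · rw [if_pos h, moveEntry, if_pos h, Finset.sum_image (fun _ _ _ _ e => List.cons_injective e),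
        mul_div_right_comm, Finset.mul_sum]
      refine Finset.sum_congr rfl fun δ hδ => ?_
      have h1 := (mem_filtrations.1 hδ).1
      cases δ with
      | nil => simp at h1
      | cons b t =>
        obtain rfl : b = nu := by simpa using h1
        simp [fUp]
    · rw [if_neg h, moveEntry, if_neg h, zero_mul, zero_div]
  · intro a _ b _ hab
    rw [Function.onFun, Finset.disjoint_left]
    intro δ ha hb
    obtain ⟨s, hs, rfl⟩ := Finset.mem_image.1 ha
    obtain ⟨t, ht, e⟩ := Finset.mem_image.1 hb
    obtain rfl := List.cons_injective e
    have h1 := (mem_filtrations.1 hs).1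
    rw [(mem_filtrations.1 ht).1] at h1
    exact hab (Option.some_injective _ h1.symm)

open Classical in
lemma filtrations_eq_biUnion_append {n : ℕ} {mu lam : n.Partition} (hne : mu ≠ lam) :
    filtrations mu lam = (Finset.univ.filter fun nu => MovesUp nu lam).biUnion
      fun nu => (filtrations mu nu).image (· ++ [lam]) := by
  ext δ
  simp only [Finset.mem_biUnion, Finset.mem_filter, Finset.mem_univ, true_and, Finset.mem_image]
  constructor
  · intro h
    obtain ⟨h1, h2, h3⟩ := mem_filtrations.1 h
    rcases List.eq_nil_or_concat δ with rfl | ⟨t, b, rfl⟩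
    · simp at h1
    · rw [List.concat_eq_append] at h1 h2 h3 ⊢
      obtain rfl : b = lam := by simpa using h2
      rcases List.eq_nil_or_concat t with rfl | ⟨t, a, rfl⟩
      · exact absurd (by simpa using h1.symm) hne
      · rw [List.concat_eq_append] at h1 h3 ⊢
        rw [List.isChain_append] at h3
        refine ⟨a, h3.2.2 a (by simp) b (by simp), t ++ [a], mem_filtrations.2
          ⟨?_, by simp, h3.1⟩, rfl⟩
        rwa [List.head?_append_of_ne_nil _ (by simp)] at h1
  · rintro ⟨nu, hnu, t, ht, rfl⟩
    obtain ⟨h1, h2, h3⟩ := mem_filtrations.1 ht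
    refine mem_filtrations.2 ⟨?_, by simp, ?_⟩
    · rw [List.head?_append, h1]
      rfl
    · rw [List.isChain_append]
      refine ⟨h3, List.isChain_singleton _, fun x hx y hy => ?_⟩
      rw [h2] at hx
      obtain rfl : nu = x := by simpa using hx
      obtain rfl : lam = y := by simpa using hy
      exact hnu

lemma fDown_append {n : ℕ} (mu a b : n.Partition) (t : List n.Partition) :
    fDown mu (t ++ [a] ++ [b]) = fDown mu (t ++ [a]) * (r a b / (ePrime mu - ePrime b)) := by
  have h : ∀ f : n.Partition → n.Partition → F,
      (List.zipWith f (t ++ [a] ++ [b]) (t ++ [a] ++ [b]).tail).prod =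
        (List.zipWith f (t ++ [a]) (t ++ [a]).tail).prod * f a b := by
    intro f
    induction t with
    | nil => simp
    | cons c t ih =>
      cases t with
      | nil => simp
      | cons d t =>
        simp only [List.cons_append, List.tail_cons, List.zipWith_cons_cons, List.prod_cons,
          mul_assoc] at ih ⊢
        rw [ih]
  exact h _

/-- Here the denominators involve the fixed start `μ` and the end of each step, so it is the last
step that splits off. -/
lemma sum_fDown_recursion {n : ℕ} {mu lam : n.Partition} (hne : mu ≠ lam) :
    ∑ δ ∈ filtrations mu lam, fDown mu δ = (∑ nu : n.Partition,
      (∑ δ ∈ filtrations mu nu, fDown mu δ) * moveEntry nu lam) / (ePrime mu - ePrime lam) := by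
  classical
  rw [filtrations_eq_biUnion_append hne, Finset.sum_biUnion, Finset.sum_filter, Finset.sum_div]
  · refine Finset.sum_congr rfl fun nu _ => ?_
    by_cases h : MovesUp nu lam
    · rw [if_pos h, moveEntry, if_pos h,
        Finset.sum_image (fun _ _ _ _ e => List.append_cancel_right e), mul_div_assoc,
        Finset.sum_mul]
      refine Finset.sum_congr rfl fun δ hδ => ?_
      have h1 := (mem_filtrations.1 hδ).2.1
      rcases List.eq_nil_or_concat δ with rfl | ⟨t, a, rfl⟩
      · simp at h1
      · rw [List.concat_eq_append] at h1 ⊢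
        obtain rfl : a = nu := by simpa using h1
        exact fDown_append mu a lam t
    · rw [if_neg h, moveEntry, if_neg h, mul_zero, zero_div]
  · intro a _ b _ hab
    rw [Function.onFun, Finset.disjoint_left]
    intro δ ha hb
    obtain ⟨s, hs, rfl⟩ := Finset.mem_image.1 ha
    obtain ⟨t, ht, e⟩ := Finset.mem_image.1 hb
    obtain rfl := List.append_cancel_right e
    have h1 := (mem_filtrations.1 hs).2.1
    rw [(mem_filtrations.1 ht).2.1] at h1
    exact hab (Option.some_injective _ h1.symm)

/-! ### The expansions of the Jack functions -/

section Expansion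

variable {P J : ∀ n : ℕ, n.Partition → SymF} {v C : ∀ n : ℕ, n.Partition → n.Partition → F}

lemma DomLT.ePrime_sub_ne_zero {n : ℕ} {mu lam : n.Partition} (h : DomLT mu lam) :
    ePrime lam - ePrime mu ≠ 0 :=
  sub_ne_zero.2 (ePrime_ne h.rowSum_lt.ne)

theorem jackJ_coeff_eq_sum_fUp (hP : IsJackP P) (hJ : IsJackJ P J v)
    (hC : ∀ (n : ℕ) (mu : n.Partition), jackQ P n mu = ∑ lam, C n mu lam • genHom P lam)
    {n : ℕ} (lam mu : n.Partition) :
    v n lam mu = v n lam lam * ∑ δ ∈ filtrations mu lam, fUp lam δ := by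
  -- For fixed `λ` the recursion expresses `v_{λμ}` through larger `ν`, so the induction descends in
  -- dominance; the one for `C` below ascends.
  induction mu using (domLT_swap_wellFounded n).induction with
  | _ mu ih =>
    by_cases hle : DomLE mu lam
    · by_cases hne : mu = lam
      · subst hne
        rw [sum_fUp_self, mul_one]
      · rw [sum_fUp_recursion hne, ← mul_div_assoc,
          eq_div_iff (DomLT.ePrime_sub_ne_zero ⟨hle, hne⟩), jackJ_coeff_recursion hP hC hJ,
          Finset.mul_sum]
        refine Finset.sum_congr rfl fun nu _ => ?_
        by_cases h0 : moveEntry mu nu = 0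
        · simp [h0]
        · rw [ih nu (domLT_of_moveEntry_ne_zero h0), mul_left_comm]
    · rw [jackJ_coeff_eq_zero hP hJ hle, filtrations_eq_empty hle, Finset.sum_empty, mul_zero]

theorem genHom_coeff_eq_sum_fDown (hP : IsJackP P)
    (hC : ∀ (n : ℕ) (mu : n.Partition), jackQ P n mu = ∑ lam, C n mu lam • genHom P lam)
    {n : ℕ} (mu lam : n.Partition) :
    C n mu lam = C n mu mu * ∑ δ ∈ filtrations mu lam, fDown mu δ := by
  rw [genHom_coeff_self hP hC, one_mul]
  induction lam using (domLT_wellFounded n).induction with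
  | _ lam ih =>
    by_cases hle : DomLE mu lam
    · by_cases hne : mu = lam
      · subst hne
        rw [sum_fDown_self, genHom_coeff_self hP hC]
      · have h0 : ePrime mu - ePrime lam ≠ 0 := by
          rw [← neg_sub, neg_ne_zero]
          exact DomLT.ePrime_sub_ne_zero ⟨hle, hne⟩
        rw [sum_fDown_recursion hne, eq_div_iff h0, genHom_coeff_recursion hP hC]
        refine Finset.sum_congr rfl fun nu _ => ?_
        by_cases h0 : moveEntry nu lam = 0
        · simp [h0]
        · rw [ih nu (domLT_of_moveEntry_ne_zero h0)]
    · rw [genHom_coeff_eq_zero hP hC hle, filtrations_eq_empty hle, Finset.sum_empty]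

end Expansion

end JackLB

end

open JackLB in
theorem theorem5p6
    (P J : ∀ n : ℕ, n.Partition → SymF)
    (v C : ∀ n : ℕ, n.Partition → n.Partition → F)
    (hP : IsJackP P)
    (hJ : IsJackJ P J v)
    (hC : ∀ (n : ℕ) (mu : n.Partition), jackQ P n mu = ∑ lam, C n mu lam • genHom P lam)
    (n : ℕ) (mu lam : n.Partition) (hlt : DomLT mu lam) :
    v n lam mu = v n lam lam * ∑ δ ∈ filtrations mu lam, fUp lam δ ∧
      C n mu lam = C n mu mu * ∑ δ ∈ filtrations mu lam, fDown mu δ ∧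
      C n mu mu = 1 := by
  exact ⟨jackJ_coeff_eq_sum_fUp hP hJ hC lam mu, genHom_coeff_eq_sum_fDown hP hC mu lam,
    genHom_coeff_self hP hC mu⟩
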